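/- **Setting.** Let $\Delta_k=\{x\in\mathbb R^k : x\ge 0,\ \sum_i x_i=1\}$, with vertices $v_1,\dots,v_k$, and let $|pq|=\frac12\|p-q\|_1$ be the length of the segment from $p$ to $q$. An instance of the $k$-way cut problem is a finite graph with nonnegative edge costs and $k$ distinct terminals; a $k$-way cut is a set of edges whose removal separates the terminals from each other, and its cost is the sum of the costs of its edges. An embedding of an instance maps the nodes to points of $\Delta_k$, terminal $i$ to $v_i$; its volume is the sum over all edges of cost times embedded length. The integrality gap (of the Călinescu–Karloff–Rabani relaxation) is the supremum, over all instances with positive minimum volume, of the minimum cost of a $k$-way cut divided by the minimum volume of an embedding. A $k$-way cut of the simplex is a partition of $\Delta_k$ into $k$ blocks, the $i$-th of which contains $v_i$ (the blocks may be arbitrary sets, in particular polytopes). A cutting scheme is a probability distribution $P$ on such cuts, for which each event "$p$ lies in block $i$" is measurable. The density of $P$ on a segment $e$ of positive length is the expected number of times that a random cut from $P$ cuts $e$ (the number of changes of block along $e$), divided by $|e|$; the maximum density $\tau_k(P)$ is the supremum of the densities over all segments $e$, and $\tau_k^*=\inf_P\tau_k(P)$. **The graphs $G_N$.** Let $k=3$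 and let $N$ be a positive integer. For $\{i,j,\ell\}=\{1,2,3\}$ and $d\in[0,1]$, let $a$ be the point of the segment $v_iv_\ell$ at distance $d$ from $v_i$, let $b$ be the point of the segment $v_jv_\ell$ at distance $d$ from $v_j$, and let $p(i,j,d)=v_ia\cup ab\cup bv_j$. For each of the three pairs $\{i,j\}$ take $N$ copies of the path $p(i,j,0)$ and the paths $p(i,j,m/(3N))$ for $m=1,\dots,2N$; these are $9N$ paths in all. The graph $G_N$ has one node at each point of $\Delta_3$ whose coordinates are integer multiples of $1/(3N)$, and an edge between any two nodes at distance $1/(3N)$, whose cost is the number of the $9N$ paths that pass through both nodes. Its terminals are the nodes at $v_1,v_2,v_3$. **Theorem.** 1. For every integer $N\ge1$, the drawing of $G_N$ in the triangle $\Delta_3$ by straight segments has no crossings (so $G_N$ is planar), the volume of this embedding is exactly $11N+1$, and every $3$-way cut of $G_N$ costs at least $12N$. 2. Every cutting scheme $P$ for $k=3$ has maximum density $\tau_3(P)\ge\frac{12}{11}$. This holds even if a segment counts as cut only when its two ends lie in different blocks, and then only once: $\sup_{p\ne q}\Pr[P\text{ separates }p\text{ and }q]/|pq|\ge\frac{12}{11}$.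 Hence $\tau_3^*\ge\frac{12}{11}$. 3. The integrality gap for $k=3$ is exactly $\frac{12}{11}$. -/

import Mathlib

open MeasureTheory
open scoped ENNReal

noncomputable section

namespace MultiwayCut

/-! ### The metric on the simplex -/

/-- Half the `L₁` distance. Distinct vertices of the simplex are at distance `1`. -/
def halfL1 {k : ℕ} (x y : Fin k → ℝ) : ℝ := (∑ i, |x i - y i|) / 2

theorem halfL1_comm {k : ℕ} (x y : Fin k → ℝ) : halfL1 x y = halfL1 y x := by
  simp [halfL1, abs_sub_comm]

/-! ### The multiway cut problem and its geometric relaxation -/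

/-- An instance of the `k`-way cut problem: a finite graph with non-negative edge costs and `k`
distinct terminals. (Only the values of `cost` on edges of the graph are ever used.) -/
structure Instance (k : ℕ) where
  V : Type
  [fintypeV : Fintype V]
  graph : SimpleGraph V
  cost : Sym2 V → ℝ
  cost_nonneg : ∀ e, 0 ≤ cost e
  terminal : Fin k → V
  terminal_injective : Function.Injective terminal

attribute [instance] Instance.fintypeV

namespace Instance

variable {k : ℕ}

/-- A `k`-way cut: a set of edges whose removal separates the terminals from each other. -/
def IsCut (G : Instance k) (C : Finset (Sym2 G.V)) : Prop :=
  (C : Set (Sym2 G.V)) ⊆ G.graph.edgeSet ∧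
    ∀ i j, i ≠ j →
      ¬ (G.graph.deleteEdges (C : Set (Sym2 G.V))).Reachable (G.terminal i) (G.terminal j)

/-- The cost of a set of edges. -/
def cutCost (G : Instance k) (C : Finset (Sym2 G.V)) : ℝ := ∑ e ∈ C, G.cost e

/-- The minimum cost of a `k`-way cut. -/
def minCutCost (G : Instance k) : ℝ := sInf {c | ∃ C, G.IsCut C ∧ c = G.cutCost C}

/-- An embedding of an instance: a map of the nodes to the simplex that sends terminal `i` to
the `i`-th vertex. Edges are mapped to straight segments. -/
structure Embedding (G : Instance k) where
  pos : G.V → stdSimplex ℝ (Fin k)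
  pos_terminal : ∀ i, pos (G.terminal i) = stdSimplex.vertex i

/-- The length of an embedded edge (more generally, of an unordered pair of nodes). -/
def Embedding.length {G : Instance k} (x : G.Embedding) (e : Sym2 G.V) : ℝ :=
  Sym2.lift ⟨fun u v => halfL1 (x.pos u) (x.pos v), fun _ _ => halfL1_comm _ _⟩ e

open Classical in
/-- The volume of an embedding: the sum over all edges of cost times length. -/
def Embedding.volume {G : Instance k} (x : G.Embedding) : ℝ :=
  ∑ e ∈ G.graph.edgeFinset, G.cost e * x.length e

/-- The minimum volume of an embedding, i.e. the value of the geometric relaxation. -/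
def minVolume (G : Instance k) : ℝ := sInf {c | ∃ x : G.Embedding, c = x.volume}

/-- The drawing of the graph by straight segments given by an embedding has no crossings: nodes
are at distinct points, an edge passes through no nodes other than its ends, and two distinct
edges meet at most in a common end. For `k = 3` the simplex is a planar triangle, so that such
an embedding shows that the graph is planar. -/
def Embedding.IsPlane {G : Instance k} (x : G.Embedding) : Prop :=
  Function.Injective x.pos ∧
  (∀ u v w, G.graph.Adj u v →
    (x.pos w : Fin k → ℝ) ∈ segment ℝ (x.pos u : Fin k → ℝ) (x.pos v) → w = u ∨ w = v) ∧
  (∀ u v u' v', G.graph.Adj u v → G.graph.Adj u' v' → s(u, v) ≠ s(u', v') →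
    ∀ p ∈ segment ℝ (x.pos u : Fin k → ℝ) (x.pos v) ∩
        segment ℝ (x.pos u' : Fin k → ℝ) (x.pos v'),
      ∃ w, (w = u ∨ w = v) ∧ (w = u' ∨ w = v') ∧ p = x.pos w)

end Instance

/-- The ratios of minimum cut cost to minimum volume, over all instances with `k` terminals for
which the ratio makes sense. The integrality gap is the supremum of this set. (If the minimum
volume is `0`, then so is the minimum cut cost.) -/
def gapRatios (k : ℕ) : Set ℝ :=
  {r | ∃ G : Instance k, 0 < G.minVolume ∧ r = G.minCutCost / G.minVolume}

/-! ### Cutting schemes -/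

/-- A `k`-way cut of the simplex: a partition of the simplex into `k` blocks, the `i`-th of which
contains the `i`-th vertex (and hence no other vertex), given by the function that maps a
point to the index of its block. The blocks need not be polytopes; so there are more cuts here
than under that additional requirement, and a lower bound for all cutting schemes says more. -/
abbrev SimplexCut (k : ℕ) : Type :=
  {c : stdSimplex ℝ (Fin k) → Fin k // ∀ i, c (stdSimplex.vertex i) = i}

/-- A cutting scheme: a probability distribution on `k`-way cuts of the simplex, for the
σ-algebra generated by the maps `c ↦ c p`, i.e. by the events that the point `p` is in block
`i`. -/
abbrev CuttingScheme (k : ℕ) : Type := ProbabilityMeasure (SimplexCut k)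

/-- The point `(1 - t) p + t q` of the segment from `p` to `q`. -/
def segPoint {k : ℕ} (p q : stdSimplex ℝ (Fin k)) (t : Set.Icc (0 : ℝ) 1) :
    stdSimplex ℝ (Fin k) :=
  ⟨AffineMap.lineMap (p : Fin k → ℝ) (q : Fin k → ℝ) (t : ℝ),
    (convex_stdSimplex ℝ (Fin k)).lineMap_mem p.2 q.2 t.2⟩

/-- The number of times that the cut `c` cuts the segment from `p` to `q`: the number of changes
of block on the way from `p` to `q`, i.e. the supremum over all finite sequences of successive
points of the segment of the number of changes of block along the sequence. -/
def numCuts {k : ℕ} (c : SimplexCut k) (p q : stdSimplex ℝ (Fin k)) : ℕ∞ :=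
  ⨆ (n : ℕ) (t : Fin (n + 1) → Set.Icc (0 : ℝ) 1) (_ : Monotone t),
    ((Finset.univ.filter fun i : Fin n =>
      c.1 (segPoint p q (t i.castSucc)) ≠ c.1 (segPoint p q (t i.succ))).card : ℕ∞)

/-- The density of `P` on the segment `pq`: the expected number of times that a random cut from
`P` cuts the segment, divided by the length of the segment. -/
def density {k : ℕ} (P : CuttingScheme k) (p q : stdSimplex ℝ (Fin k)) : ℝ≥0∞ :=
  (∫⁻ c, (numCuts c p q : ℝ≥0∞) ∂(P : Measure (SimplexCut k))) / ENNReal.ofReal (halfL1 p q)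

/-- The maximum density `τ_k(P)`: the supremum of the densities on all segments. -/
def maxDensity {k : ℕ} (P : CuttingScheme k) : ℝ≥0∞ :=
  ⨆ (p : stdSimplex ℝ (Fin k)) (q : stdSimplex ℝ (Fin k)) (_ : p ≠ q), density P p q

/-- The minimum maximum density `τ_k^*`. -/
def minMaxDensity (k : ℕ) : ℝ≥0∞ := ⨅ P : CuttingScheme k, maxDensity P

/-- The variant of the maximum density that counts a segment as cut only if its ends are in
different blocks, and then only once: the supremum over all segments of the probability that
the ends are separated, divided by the length. -/
def maxSeparationDensity {k : ℕ} (P : CuttingScheme k) : ℝ≥0∞ :=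
  ⨆ (p : stdSimplex ℝ (Fin k)) (q : stdSimplex ℝ (Fin k)) (_ : p ≠ q),
    (P : Measure (SimplexCut k)) {c | c.1 p ≠ c.1 q} / ENNReal.ofReal (halfL1 p q)

/-! ### The graphs `G_N` -/

/-- The path `p(i, j, d)`, as a set of points, where `l` is the third terminal: the union of the
segments `ia`, `ab`, `bj`, where `a` is the point of the segment `il` at distance `d` from `i`
and `b` is the point of the segment `jl` at distance `d` from `j`. -/
def path (i j l : Fin 3) (d : ℝ) : Set (Fin 3 → ℝ) :=
  let vi : Fin 3 → ℝ := Pi.single i 1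
  let vj : Fin 3 → ℝ := Pi.single j 1
  let vl : Fin 3 → ℝ := Pi.single l 1
  let a := AffineMap.lineMap vi vl d
  let b := AffineMap.lineMap vj vl d
  segment ℝ vi a ∪ segment ℝ a b ∪ segment ℝ b vj

/-- The `9N` paths that make up `G_N`. A path is indexed by the terminal `l` that is not one of
its two ends, and by the number of the path among the `3N` paths with these ends: there are
`N` copies of `p(i, j, 0)`, and the paths `p(i, j, m / (3N))` for `m = 1, …, 2N`. -/
def pathFamily (N : ℕ) : Fin 3 × (Fin N ⊕ Fin (2 * N)) → Set (Fin 3 → ℝ)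
  | (l, Sum.inl _) => path (l + 1) (l + 2) l 0
  | (l, Sum.inr m) => path (l + 1) (l + 2) l (((m : ℝ) + 1) / (3 * N))

/-- The nodes of `G_N`: one for each point of the simplex whose coordinates are integer multiples
of `1 / (3N)`; the node `v` stands for the point with coordinates `v i / (3N)`. -/
abbrev GridNode (N : ℕ) : Type :=
  ↥(Finset.piAntidiag (Finset.univ : Finset (Fin 3)) (3 * N))

/-- The point at which a node of `G_N` is embedded. -/
def gridPos (N : ℕ) (hN : 0 < N) (v : GridNode N) : stdSimplex ℝ (Fin 3) :=
  ⟨fun i => (v.1 i : ℝ) / (3 * N), by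
    have h := (Finset.mem_piAntidiag.1 v.2).1
    have hN' : (0 : ℝ) < 3 * N := by positivity
    refine ⟨fun i => by positivity, ?_⟩
    rw [← Finset.sum_div, ← Nat.cast_sum, h]
    push_cast
    exact div_self hN'.ne'⟩

open Classical in
/-- The weighted graph `G_N`: nodes are adjacent if they are embedded at distance `1 / (3N)`, and
the cost of an edge is the number of the `9N` paths that pass through both of its ends. -/
def lowerBoundGraph (N : ℕ) (hN : 0 < N) : Instance 3 where
  V := GridNode N
  graph :=
    { Adj := fun u v => halfL1 (gridPos N hN u) (gridPos N hN v) = 1 / (3 * N)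
      symm := ⟨fun u v h => by rw [halfL1_comm]; exact h⟩
      loopless := ⟨fun u h => by
        have hN' : (0 : ℝ) < 1 / (3 * N) := by positivity
        simp only [halfL1, sub_self, abs_zero, Finset.sum_const_zero, zero_div] at h
        exact hN'.ne h⟩ }
  cost := fun e => ((Finset.univ.filter fun ι =>
    ∀ u ∈ e, (gridPos N hN u : Fin 3 → ℝ) ∈ pathFamily N ι).card : ℝ)
  cost_nonneg := fun _ => Nat.cast_nonneg _
  terminal := fun i => ⟨Pi.single i (3 * N), by simp [Finset.mem_piAntidiag]⟩
  terminal_injective := fun i j h => by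
    by_contra hij
    have h1 := congrFun (congrArg Subtype.val h) i
    simp only [Pi.single_eq_same, Pi.single_eq_of_ne hij] at h1
    omega

/-- The embedding of `G_N`. -/
def lowerBoundEmbedding (N : ℕ) (hN : 0 < N) : (lowerBoundGraph N hN).Embedding where
  pos := gridPos N hN
  pos_terminal := fun i => by
    have hN' : (3 * (N : ℝ)) ≠ 0 := by positivity
    apply Subtype.ext
    funext j
    by_cases hij : j = i
    · subst hij
      simp [gridPos, lowerBoundGraph, hN.ne']
    · simp [gridPos, lowerBoundGraph, hij]

end MultiwayCut

end

/-!
# Three-way cuts and the constant `12 / 11`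

Scale the triangle so that the nodes of `G_N` are the integer points `x ≥ 0` with
`x 0 + x 1 + x 2 = 3 N`. The edges of `G_N` correspond to the pairs `(l, x)` with `x` an integer
point of the triangle of side `3 N - 1`: the edge joins `x + e (l + 1)` and `x + e (l + 2)`.
Summing over the edges of the `9 N` paths instead of over the edges of the graph (`sum_paths`)
gives the volume, and turns the cost of a cut into the total number of label changes along the
paths, where each node is labelled by the terminal on whose side of the cut it is.

**Cuts of `G_N` cost at least `12 N`** (`le_sum_weight_change`). Relabelling the nodes near
terminal `i` (those with `x i > 2 N`) by `i` does not increase the number of changes along any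
path, since a path meets these corners only in an initial and a final part
(`sum_change_fillCorners_le`). For a path from `l + 1` to `l + 2` let the potential of a label be
`0` at `l + 1`, `2` at `l` and `4` at `l + 2`. Then three times the number of changes along an edge
is the difference of the potentials, plus `6` if the potential falls, minus `1` or plus `1`
according to the cyclic orientation of the change (`three_mul_change`). The potentials telescope
to `4` on each path, which accounts for `36 N`. As the corners are filled, the rest is at least a
sum of contributions of the small triangles of the grid, upward and downward ones, plus multiples
of descents on the sides, and each contribution is non-negative by inspection of the `27`
labellings of a triangle (`upward_triangle_nonneg`, `downward_triangle_nonneg`). The point is that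
a triangle with three labels of the wrong orientation always has an edge along which a potential
falls.

**Cutting schemes.** A cut of the simplex labels the nodes of `G_N`. Taking expectations in the
bound for cuts gives `12 N ≤ τ (11 N + 1)`, where `τ` is the maximum separation density, for every
`N`; so `τ ≥ 12 / 11`.

**The integrality gap.** `G_N` shows that it is at least `12 N / (11 N + 1)`. For the upper bound
an embedding is rounded by a random cut (`minCutCost_le_mul_volume`). With probability `8 / 11`
this is a cut with a center `q` from which three rays parallel to the sides emanate; each of the
rays goes in one of two directions, decided by a fair coin, and all coordinates of `q` are
uniformly distributed in `(0, 2 / 3)` (`center`). With probability `3 / 11` two of the three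
terminals are sliced off, at a common distance that is uniformly distributed in `(0, 1 / 3)`.
A cut of the first kind separates `x` and `y` with probability at most half the expected number
of `i` for which `q i` lies between `x i` and `y i`. As `8 / 11 * 1 / 2 * 3 / 2 = 6 / 11` and
`3 / 11 * 2 / 3 * 3 = 6 / 11`, the two kinds together separate `x` and `y` with probability at most
`6 / 11 * ∑ i, |x i - y i|`, which is `12 / 11` times their distance.
-/

namespace MultiwayCut

/-! ### Arithmetic of three indices -/

theorem add_one_ne (l : Fin 3) : l + 1 ≠ l := by fin_cases l <;> decide
theorem add_two_ne (l : Fin 3) : l + 2 ≠ l := by fin_cases l <;> decide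
theorem add_one_ne_add_two (l : Fin 3) : l + 1 ≠ l + 2 := by fin_cases l <;> decide
theorem add_two_add_one (l : Fin 3) : l + 2 + 1 = l := by fin_cases l <;> decide
theorem add_two_add_two (l : Fin 3) : l + 2 + 2 = l + 1 := by fin_cases l <;> decide
theorem add_one_add_one (l : Fin 3) : l + 1 + 1 = l + 2 := by fin_cases l <;> decide
theorem add_one_add_two (l : Fin 3) : l + 1 + 2 = l := by fin_cases l <;> decide

theorem eq_or_eq_or_eq (l i : Fin 3) : i = l ∨ i = l + 1 ∨ i = l + 2 := by
  revert l i; decide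

theorem sum_fin_three {M : Type*} [AddCommMonoid M] (l : Fin 3) (f : Fin 3 → M) :
    ∑ k, f k = f l + f (l + 1) + f (l + 2) := by
  rw [Fin.sum_univ_three]
  fin_cases l <;> simp <;> abel

/-! ### Label changes along an edge -/

/-- `1` if the labels `a` and `b` differ, and `0` otherwise. -/
def change (a b : Fin 3) : ℤ := if a = b then 0 else 1

/-- `1` for a step `a → a + 1` in the cyclic order of the labels, `-1` for a step `a + 1 → a`. -/
def orient (a b : Fin 3) : ℤ := if b = a + 1 then 1 else if a = b + 1 then -1 else 0

/-- A potential on the labels that is adapted to the paths from terminal `l + 1` to terminal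
`l + 2`: on such a path it rises from `0` to `4`, and `l` lies half-way. -/
def potential (l a : Fin 3) : ℤ := if a = l + 1 then 0 else if a = l + 2 then 4 else 2

/-- `1` if the potential falls from label `a` to label `b`, and `0` otherwise. -/
def descent (l a b : Fin 3) : ℤ := if potential l b < potential l a then 1 else 0

theorem change_comm (a b : Fin 3) : change a b = change b a := by simp [change, eq_comm]

theorem change_triangle (a b c : Fin 3) : change a c ≤ change a b + change b c := by
  revert a b c; decide

theorem descent_nonneg (l a b : Fin 3) : 0 ≤ descent l a b := by
  unfold descent; split_ifs <;> simp

theorem orient_swap (a b : Fin 3) : orient b a = -orient a b := by revert a b; decide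

theorem orient_self (a : Fin 3) : orient a a = 0 := by revert a; decide

theorem descent_self (l a : Fin 3) : descent l a a = 0 := by simp [descent]

/-- The identity that drives the lower bound on cuts: up to the cyclic orientation of the step
and the descents of the potential, the number of changes is a difference of potentials. -/
theorem three_mul_change (l a b : Fin 3) :
    3 * change a b = potential l b - potential l a + (6 * descent l a b - orient a b) := by
  revert l a b; decide

/-- An upward triangle with labels `a i` at the corner in the direction of terminal `i`. -/
theorem upward_triangle_nonneg (a : Fin 3 → Fin 3) :
    0 ≤ ∑ l : Fin 3,
      (3 * descent l (a (l + 1)) (a (l + 2)) + orient (a (l + 1)) (a (l + 2))) := by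
  have key : ∀ x y z : Fin 3, 0 ≤ (3 * descent 0 y z + orient y z) +
      (3 * descent 1 z x + orient z x) + (3 * descent 2 x y + orient x y) := by decide
  rw [Fin.sum_univ_three]
  exact key (a 0) (a 1) (a 2)

/-- A downward triangle with labels `a i` at the corner facing away from terminal `i`. -/
theorem downward_triangle_nonneg (a : Fin 3 → Fin 3) :
    0 ≤ ∑ l : Fin 3,
      (3 * descent l (a (l + 2)) (a (l + 1)) - 2 * orient (a (l + 2)) (a (l + 1))) := by
  have key : ∀ x y z : Fin 3, 0 ≤ (3 * descent 0 z y - 2 * orient z y) +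
      (3 * descent 1 x z - 2 * orient x z) + (3 * descent 2 y x - 2 * orient y x) := by decide
  rw [Fin.sum_univ_three]
  exact key (a 0) (a 1) (a 2)

theorem change_le_sum_Ico (g : ℕ → Fin 3) {a b : ℕ} (hab : a ≤ b) :
    change (g a) (g b) ≤ ∑ k ∈ Finset.Ico a b, change (g k) (g (k + 1)) := by
  induction b, hab using Nat.le_induction with
  | base => simp [change]
  | succ b hab ih =>
    rw [Finset.sum_Ico_succ_top hab]
    exact (change_triangle _ (g b) _).trans (by gcongr)

/-- A monotone reparametrization does not increase the number of changes along a sequence. -/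
theorem sum_change_comp_le (g : ℕ → Fin 3) {φ : ℕ → ℕ} (hφ : Monotone φ) (L : ℕ) :
    ∑ k ∈ Finset.range L, change (g (φ k)) (g (φ (k + 1))) ≤
      ∑ k ∈ Finset.Ico (φ 0) (φ L), change (g k) (g (k + 1)) := by
  induction L with
  | zero => simp
  | succ L ih =>
    rw [Finset.sum_range_succ,
      ← Finset.sum_Ico_consecutive _ (hφ (Nat.zero_le L)) (hφ (Nat.le_succ L))]
    exact add_le_add ih (change_le_sum_Ico g (hφ (Nat.le_succ L)))

/-! ### Points, edges and paths of the triangular grid -/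

/-- The grid points of a triangle with side `n`, in barycentric coordinates. -/
abbrev grid (n : ℕ) : Finset (Fin 3 → ℕ) := Finset.piAntidiag Finset.univ n

theorem mem_grid {n : ℕ} {x : Fin 3 → ℕ} : x ∈ grid n ↔ x 0 + x 1 + x 2 = n := by
  simp [Finset.mem_piAntidiag, Fin.sum_univ_three]

theorem sum_eq_of_mem_grid {n : ℕ} {x : Fin 3 → ℕ} (hx : x ∈ grid n) (l : Fin 3) :
    x l + x (l + 1) + x (l + 2) = n := by
  have h := mem_grid.1 hx
  fin_cases l <;> simp <;> omega

/-- The point with coordinates `m` at `l`, `a` at `l + 2`, and `n - m - a` at `l + 1`. -/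
def gridPoint (n : ℕ) (l : Fin 3) (m a : ℕ) : Fin 3 → ℕ :=
  fun i => if i = l then m else if i = l + 2 then a else n - m - a

@[simp] theorem gridPoint_apply (n : ℕ) (l : Fin 3) (m a : ℕ) : gridPoint n l m a l = m := by
  simp [gridPoint]

@[simp] theorem gridPoint_apply_add_one (n : ℕ) (l : Fin 3) (m a : ℕ) :
    gridPoint n l m a (l + 1) = n - m - a := by
  fin_cases l <;> simp [gridPoint]

@[simp] theorem gridPoint_apply_add_two (n : ℕ) (l : Fin 3) (m a : ℕ) :
    gridPoint n l m a (l + 2) = a := by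
  fin_cases l <;> simp [gridPoint]

theorem ext_fin_three {x y : Fin 3 → ℕ} (l : Fin 3) (h0 : x l = y l)
    (h1 : x (l + 1) = y (l + 1)) (h2 : x (l + 2) = y (l + 2)) : x = y := by
  funext i
  fin_cases l <;> fin_cases i <;> simp_all

theorem gridPoint_mem_grid {n : ℕ} (l : Fin 3) {m a : ℕ} (h : m + a ≤ n) :
    gridPoint n l m a ∈ grid n := by
  rw [mem_grid]
  fin_cases l <;> simp [gridPoint] <;> omega

theorem gridPoint_of_mem_grid {n : ℕ} {x : Fin 3 → ℕ} (hx : x ∈ grid n) (l : Fin 3) :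
    gridPoint n l (x l) (x (l + 2)) = x := by
  have h := sum_eq_of_mem_grid hx l
  refine ext_fin_three l ?_ ?_ ?_ <;> simp
  omega

theorem add_single_mem_grid {n : ℕ} {x : Fin 3 → ℕ} (hx : x ∈ grid n) (l : Fin 3) :
    x + Pi.single l 1 ∈ grid (n + 1) := by
  rw [mem_grid] at hx ⊢
  fin_cases l <;> simp <;> omega

theorem gridPoint_add_single {n : ℕ} (l : Fin 3) (m a : ℕ) :
    gridPoint n l m a + Pi.single l 1 = gridPoint (n + 1) l (m + 1) a := by
  funext i
  fin_cases l <;> fin_cases i <;> simp [gridPoint]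

theorem gridPoint_add_single_add_one {n : ℕ} (l : Fin 3) {m a : ℕ} (h : m + a ≤ n) :
    gridPoint n l m a + Pi.single (l + 1) 1 = gridPoint (n + 1) l m a := by
  funext i
  fin_cases l <;> fin_cases i <;> simp [gridPoint] <;> omega

theorem gridPoint_add_single_add_two {n : ℕ} (l : Fin 3) (m a : ℕ) :
    gridPoint n l m a + Pi.single (l + 2) 1 = gridPoint (n + 1) l m (a + 1) := by
  funext i
  fin_cases l <;> fin_cases i <;> simp [gridPoint] <;> omega

/-- The `k`-th node of the path of depth `m` from terminal `l + 1` to terminal `l + 2`, for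
`k = 0, …, n + m`. -/
def pathNode (n : ℕ) (l : Fin 3) (m k : ℕ) : Fin 3 → ℕ :=
  gridPoint n l (min k (min m (n + m - k))) (k - m)

/-- Whether the edge between `x + e (l + 1)` and `x + e (l + 2)` lies on the path of depth `m`
from terminal `k + 1` to terminal `k + 2`. -/
def OnPath (k : Fin 3) (m : ℕ) (l : Fin 3) (x : Fin 3 → ℕ) : Prop :=
  if l = k then x k = m else x l = 0 ∧ x k < m

instance (k : Fin 3) (m : ℕ) (l : Fin 3) (x : Fin 3 → ℕ) : Decidable (OnPath k m l x) := by
  unfold OnPath; infer_instance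

theorem sum_grid_line {n : ℕ} (k : Fin 3) {m : ℕ} (hm : m ≤ n) (f : (Fin 3 → ℕ) → ℤ) :
    (∑ x ∈ grid n, if x k = m then f x else 0) =
      ∑ a ∈ Finset.range (n + 1 - m), f (gridPoint n k m a) := by
  rw [← Finset.sum_filter]
  refine Finset.sum_nbij' (fun x => x (k + 2)) (fun a => gridPoint n k m a) ?_ ?_ ?_ ?_ ?_
  · intro x hx
    rw [Finset.mem_filter] at hx
    have := sum_eq_of_mem_grid hx.1 k
    simp only [Finset.mem_range]; omega
  · intro a ha
    rw [Finset.mem_range] at ha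
    simp only [Finset.mem_filter, gridPoint_apply, and_true]
    exact gridPoint_mem_grid k (by omega)
  · intro x hx
    rw [Finset.mem_filter] at hx
    rw [← hx.2]; exact gridPoint_of_mem_grid hx.1 k
  · intro a ha; simp
  · intro x hx
    rw [Finset.mem_filter] at hx
    rw [← hx.2, gridPoint_of_mem_grid hx.1 k]

theorem sum_grid_start {n : ℕ} (k : Fin 3) {m : ℕ} (hm : m ≤ n) (f : (Fin 3 → ℕ) → ℤ) :
    (∑ x ∈ grid n, if x (k + 2) = 0 ∧ x k < m then f x else 0) =
      ∑ b ∈ Finset.range m, f (gridPoint n k b 0) := by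
  rw [← Finset.sum_filter]
  have key : ∀ x ∈ Finset.filter (fun x : Fin 3 → ℕ => x (k + 2) = 0 ∧ x k < m) (grid n),
      gridPoint n k (x k) 0 = x := by
    intro x hx
    rw [Finset.mem_filter] at hx
    conv_rhs => rw [← gridPoint_of_mem_grid hx.1 k, hx.2.1]
  refine Finset.sum_nbij' (fun x => x k) (fun b => gridPoint n k b 0) ?_ ?_ key ?_ ?_
  · intro x hx
    rw [Finset.mem_filter] at hx
    simpa using hx.2.2
  · intro b hb
    rw [Finset.mem_range] at hb
    simp only [Finset.mem_filter, gridPoint_apply, gridPoint_apply_add_two, hb, and_true]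
    exact gridPoint_mem_grid k (by omega)
  · intro a ha; simp
  · intro x hx; rw [key x hx]

theorem sum_grid_end {n : ℕ} (k : Fin 3) {m : ℕ} (hm : m ≤ n) (f : (Fin 3 → ℕ) → ℤ) :
    (∑ x ∈ grid n, if x (k + 1) = 0 ∧ x k < m then f x else 0) =
      ∑ b ∈ Finset.range m, f (gridPoint n k b (n - b)) := by
  rw [← Finset.sum_filter]
  have key : ∀ x ∈ Finset.filter (fun x : Fin 3 → ℕ => x (k + 1) = 0 ∧ x k < m) (grid n),
      gridPoint n k (x k) (n - x k) = x := by
    intro x hx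
    rw [Finset.mem_filter] at hx
    have := sum_eq_of_mem_grid hx.1 k
    refine ext_fin_three k ?_ ?_ ?_ <;> simp <;> omega
  refine Finset.sum_nbij' (fun x => x k) (fun b => gridPoint n k b (n - b)) ?_ ?_ key ?_ ?_
  · intro x hx
    rw [Finset.mem_filter] at hx
    simpa using hx.2.2
  · intro b hb
    rw [Finset.mem_range] at hb
    simp only [Finset.mem_filter, gridPoint_apply, gridPoint_apply_add_one, hb, and_true]
    exact ⟨gridPoint_mem_grid k (by omega), by omega⟩
  · intro a ha; simp
  · intro x hx; rw [key x hx]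

/-- A sum over the steps of a path, as a sum over the edges `(l, x)` of the grid that lie on it.
Edges in the direction of the path's middle part are traversed from `x + e (l + 1)` to
`x + e (l + 2)`, the edges of the two other parts in the opposite direction. -/
theorem sum_pathNode {n : ℕ} (k : Fin 3) {m : ℕ} (hm : m ≤ n)
    (F : (Fin 3 → ℕ) → (Fin 3 → ℕ) → ℤ) :
    ∑ j ∈ Finset.range (n + 1 + m), F (pathNode (n + 1) k m j) (pathNode (n + 1) k m (j + 1)) =
      ∑ x ∈ grid n, ∑ l : Fin 3, if OnPath k m l x then
        if l = k then F (x + Pi.single (l + 1) 1) (x + Pi.single (l + 2) 1)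
        else F (x + Pi.single (l + 2) 1) (x + Pi.single (l + 1) 1) else 0 := by
  have h1 : k + 1 ≠ k := add_one_ne k
  have h2 : k + 2 ≠ k := add_two_ne k
  have hR : ∀ x : Fin 3 → ℕ, (∑ l : Fin 3, if OnPath k m l x then
        if l = k then F (x + Pi.single (l + 1) 1) (x + Pi.single (l + 2) 1)
        else F (x + Pi.single (l + 2) 1) (x + Pi.single (l + 1) 1) else 0) =
      (if x k = m then F (x + Pi.single (k + 1) 1) (x + Pi.single (k + 2) 1) else 0) +
      (if x (k + 2) = 0 ∧ x k < m then F (x + Pi.single (k + 1) 1) (x + Pi.single k 1) else 0) +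
      (if x (k + 1) = 0 ∧ x k < m then F (x + Pi.single k 1) (x + Pi.single (k + 2) 1)
        else 0) := by
    intro x
    rw [sum_fin_three k, add_right_comm]
    simp only [OnPath, if_true, if_neg h1, if_neg h2, add_two_add_one, add_two_add_two,
      add_one_add_one, add_one_add_two]
  simp only [hR, Finset.sum_add_distrib]
  rw [sum_grid_line k hm, sum_grid_start k hm, sum_grid_end k hm]
  rw [show n + 1 + m = m + (n + 1 - m) + m by omega, Finset.sum_range_add, Finset.sum_range_add]
  have hA : ∑ j ∈ Finset.range m, F (pathNode (n + 1) k m j) (pathNode (n + 1) k m (j + 1)) =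
      ∑ b ∈ Finset.range m, F (gridPoint n k b 0 + Pi.single (k + 1) 1)
        (gridPoint n k b 0 + Pi.single k 1) := by
    refine Finset.sum_congr rfl fun b hb => ?_
    rw [Finset.mem_range] at hb
    rw [gridPoint_add_single_add_one k (by omega), gridPoint_add_single, pathNode, pathNode]
    congr 2 <;> omega
  have hB : ∑ a ∈ Finset.range (n + 1 - m),
      F (pathNode (n + 1) k m (m + a)) (pathNode (n + 1) k m (m + a + 1)) =
      ∑ a ∈ Finset.range (n + 1 - m), F (gridPoint n k m a + Pi.single (k + 1) 1)
        (gridPoint n k m a + Pi.single (k + 2) 1) := by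
    refine Finset.sum_congr rfl fun a ha => ?_
    rw [Finset.mem_range] at ha
    rw [gridPoint_add_single_add_one k (by omega), gridPoint_add_single_add_two, pathNode,
      pathNode]
    congr 2 <;> omega
  have hC : ∑ j ∈ Finset.range m, F (pathNode (n + 1) k m (m + (n + 1 - m) + j))
      (pathNode (n + 1) k m (m + (n + 1 - m) + j + 1)) =
      ∑ b ∈ Finset.range m, F (gridPoint n k b (n - b) + Pi.single k 1)
        (gridPoint n k b (n - b) + Pi.single (k + 2) 1) := by
    rw [← Finset.sum_range_reflect]
    refine Finset.sum_congr rfl fun b hb => ?_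
    rw [Finset.mem_range] at hb
    rw [gridPoint_add_single, gridPoint_add_single_add_two, pathNode, pathNode]
    congr 2 <;> omega
  rw [hA, hB, hC]
  ring

/-! ### The lower bound on cuts -/

/-- The depths of the `3N` paths between two terminals. -/
def depth {N : ℕ} : Fin N ⊕ Fin (2 * N) → ℕ
  | Sum.inl _ => 0
  | Sum.inr m => m + 1

@[simp] theorem depth_inl {N : ℕ} (i : Fin N) : depth (N := N) (Sum.inl i) = 0 := rfl

@[simp] theorem depth_inr {N : ℕ} (i : Fin (2 * N)) : depth (Sum.inr i) = i + 1 := rfl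

theorem depth_le {N : ℕ} (i : Fin N ⊕ Fin (2 * N)) : depth i ≤ 2 * N := by
  rcases i with i | i
  · exact Nat.zero_le _
  · exact i.2

/-- The number of the `9N` paths on which the edge between `x + e (l + 1)` and `x + e (l + 2)`
lies. -/
def weight (N : ℕ) (l : Fin 3) (x : Fin 3 → ℕ) : ℕ :=
  (Finset.univ.filter fun ι : Fin 3 × (Fin N ⊕ Fin (2 * N)) =>
    OnPath ι.1 (depth ι.2) l x).card

/-- A sum over the steps of all paths, as a sum over the edges of the grid. -/
theorem sum_paths (N : ℕ) {n : ℕ} (hn : n + 1 = 3 * N)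
    (F : Fin 3 → (Fin 3 → ℕ) → (Fin 3 → ℕ) → ℤ) :
    (∑ ι : Fin 3 × (Fin N ⊕ Fin (2 * N)), ∑ j ∈ Finset.range (3 * N + depth ι.2),
      F ι.1 (pathNode (3 * N) ι.1 (depth ι.2) j) (pathNode (3 * N) ι.1 (depth ι.2) (j + 1))) =
    ∑ x ∈ grid n, ∑ l : Fin 3, ∑ ι : Fin 3 × (Fin N ⊕ Fin (2 * N)),
      if OnPath ι.1 (depth ι.2) l x then
        if l = ι.1 then F ι.1 (x + Pi.single (l + 1) 1) (x + Pi.single (l + 2) 1)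
        else F ι.1 (x + Pi.single (l + 2) 1) (x + Pi.single (l + 1) 1) else 0 := by
  have h : ∀ ι : Fin 3 × (Fin N ⊕ Fin (2 * N)), ∑ j ∈ Finset.range (3 * N + depth ι.2),
      F ι.1 (pathNode (3 * N) ι.1 (depth ι.2) j) (pathNode (3 * N) ι.1 (depth ι.2) (j + 1)) =
      ∑ x ∈ grid n, ∑ l : Fin 3, if OnPath ι.1 (depth ι.2) l x then
        if l = ι.1 then F ι.1 (x + Pi.single (l + 1) 1) (x + Pi.single (l + 2) 1)
        else F ι.1 (x + Pi.single (l + 2) 1) (x + Pi.single (l + 1) 1) else 0 := by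
    intro ι
    have := depth_le ι.2
    rw [← hn]
    exact sum_pathNode ι.1 (by omega) (F ι.1)
  rw [Finset.sum_congr rfl fun ι _ => h ι, Finset.sum_comm]
  exact Finset.sum_congr rfl fun x _ => Finset.sum_comm

/-- The sum over all paths of the number of label changes is the weighted number of edges whose
ends have different labels. -/
theorem sum_paths_change (N : ℕ) {n : ℕ} (hn : n + 1 = 3 * N) (c : (Fin 3 → ℕ) → Fin 3) :
    (∑ ι : Fin 3 × (Fin N ⊕ Fin (2 * N)), ∑ j ∈ Finset.range (3 * N + depth ι.2),
      change (c (pathNode (3 * N) ι.1 (depth ι.2) j))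
        (c (pathNode (3 * N) ι.1 (depth ι.2) (j + 1)))) =
    ∑ x ∈ grid n, ∑ l : Fin 3, (weight N l x : ℤ) *
      change (c (x + Pi.single (l + 1) 1)) (c (x + Pi.single (l + 2) 1)) := by
  rw [sum_paths N hn fun _ u w => change (c u) (c w)]
  refine Finset.sum_congr rfl fun x _ => Finset.sum_congr rfl fun l _ => ?_
  rw [weight, Finset.card_filter, Nat.cast_sum, Finset.sum_mul]
  refine Finset.sum_congr rfl fun ι _ => ?_
  rw [change_comm (c (x + Pi.single (l + 2) 1))]
  split_ifs <;> simp

/-- The labelling `c`, changed to `i` in the corner triangle of side less than `N` at each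
terminal `i`. -/
def fillCorners (N : ℕ) (c : (Fin 3 → ℕ) → Fin 3) (x : Fin 3 → ℕ) : Fin 3 :=
  if 2 * N < x 0 then 0 else if 2 * N < x 1 then 1 else if 2 * N < x 2 then 2 else c x

theorem fillCorners_of_lt {N : ℕ} {c : (Fin 3 → ℕ) → Fin 3} {x : Fin 3 → ℕ}
    (hx : x ∈ grid (3 * N)) {i : Fin 3} (hi : 2 * N < x i) : fillCorners N c x = i := by
  have h := mem_grid.1 hx
  unfold fillCorners
  fin_cases i <;> simp at hi <;> split_ifs <;> first | rfl | omega

theorem fillCorners_of_forall_le {N : ℕ} {c : (Fin 3 → ℕ) → Fin 3} {x : Fin 3 → ℕ}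
    (h : ∀ i, x i ≤ 2 * N) : fillCorners N c x = c x := by
  simp [fillCorners, (h _).not_gt]

/-- Filling the corners does not increase the number of label changes along any of the paths,
because the path passes through the corners at its ends only. -/
theorem sum_change_fillCorners_le {N : ℕ} (hN : 0 < N) (c : (Fin 3 → ℕ) → Fin 3)
    (hc : ∀ i, c (Pi.single i (3 * N)) = i) (l : Fin 3) {m : ℕ} (hm : m ≤ 2 * N) :
    ∑ j ∈ Finset.range (3 * N + m), change (fillCorners N c (pathNode (3 * N) l m j))
        (fillCorners N c (pathNode (3 * N) l m (j + 1))) ≤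
      ∑ j ∈ Finset.range (3 * N + m), change (c (pathNode (3 * N) l m j))
        (c (pathNode (3 * N) l m (j + 1))) := by
  -- The filled corners repeat the labels of the two ends of the path, so that filling them amounts
  -- to stopping at the start for the first `N` nodes and at the end for the last `N` nodes.
  set φ : ℕ → ℕ := fun k => if k < N then 0 else if 2 * N + m < k then 3 * N + m else
    min k (3 * N + m) with hφ
  have hmono : Monotone φ := by
    intro a b hab
    simp only [hφ]
    split_ifs <;> omega
  have hfill : ∀ k ≤ 3 * N + m,
      fillCorners N c (pathNode (3 * N) l m k) = c (pathNode (3 * N) l m (φ k)) := by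
    intro k hk
    have hmem : pathNode (3 * N) l m k ∈ grid (3 * N) := gridPoint_mem_grid l (by omega)
    have h0 : pathNode (3 * N) l m k l ≤ m := by simp [pathNode]
    have h1 : pathNode (3 * N) l m k (l + 1) = 3 * N - k := by simp [pathNode]; omega
    have h2 : pathNode (3 * N) l m k (l + 2) = k - m := by simp [pathNode]
    simp only [hφ]
    split_ifs with hk1 hk2
    · rw [fillCorners_of_lt hmem (i := l + 1) (by omega)]
      have : pathNode (3 * N) l m 0 = Pi.single (l + 1) (3 * N) := by
        funext i
        fin_cases l <;> fin_cases i <;> simp [pathNode, gridPoint]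
      rw [this, hc]
    · rw [fillCorners_of_lt hmem (i := l + 2) (by omega)]
      have : pathNode (3 * N) l m (3 * N + m) = Pi.single (l + 2) (3 * N) := by
        funext i
        fin_cases l <;> fin_cases i <;> simp [pathNode, gridPoint]
      rw [this, hc]
    · rw [min_eq_left hk, fillCorners_of_forall_le]
      intro i
      rcases eq_or_eq_or_eq l i with rfl | rfl | rfl <;> omega
  have hle := sum_change_comp_le (fun k => c (pathNode (3 * N) l m k)) hmono (3 * N + m)
  have hφ0 : φ 0 = 0 := by simp [hφ, hN]
  have hφL : φ (3 * N + m) = 3 * N + m := by simp only [hφ]; split_ifs <;> omega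
  rw [hφ0, hφL, ← Finset.range_eq_Ico] at hle
  refine le_trans (le_of_eq (Finset.sum_congr rfl fun k hk => ?_)) hle
  rw [Finset.mem_range] at hk
  rw [hfill k hk.le, hfill (k + 1) hk]

theorem card_depth_eq_zero (N : ℕ) :
    (Finset.univ.filter fun i : Fin N ⊕ Fin (2 * N) => depth i = 0).card = N := by
  rw [Finset.card_filter, Fintype.sum_sum_type]
  simp [depth]

theorem card_depth_eq {N m : ℕ} (h0 : m ≠ 0) (hm : m ≤ 2 * N) :
    (Finset.univ.filter fun i : Fin N ⊕ Fin (2 * N) => depth i = m).card = 1 := by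
  rw [Finset.card_eq_one]
  refine ⟨Sum.inr ⟨m - 1, by omega⟩, ?_⟩
  ext i
  rw [Finset.mem_filter, Finset.mem_singleton]
  rcases i with i | i
  · simpa using h0.symm
  · simp only [Finset.mem_univ, true_and, depth_inr, Sum.inr.injEq, Fin.ext_iff]
    omega

theorem card_lt_depth (N m : ℕ) :
    (Finset.univ.filter fun i : Fin N ⊕ Fin (2 * N) => m < depth i).card = 2 * N - m := by
  have h : (Finset.univ.filter fun i : Fin N ⊕ Fin (2 * N) => m < depth i).card =
      (Finset.Ico m (2 * N)).card := by
    refine Finset.card_bij (fun i _ => depth i - 1) ?_ ?_ ?_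
    · rintro (i | i) hi <;> simp at hi ⊢
      omega
    · rintro (i | i) hi (j | j) hj hij <;> simp at hi hj hij ⊢
      omega
    · intro k hk
      rw [Finset.mem_Ico] at hk
      exact ⟨Sum.inr ⟨k, hk.2⟩, by simp; omega, by simp⟩
  rw [h, Nat.card_Ico]

/-- A sum over the paths through an edge. -/
theorem sum_onPath (N : ℕ) (l : Fin 3) (x : Fin 3 → ℕ) (f : Fin 3 → ℤ) :
    (∑ ι : Fin 3 × (Fin N ⊕ Fin (2 * N)), if OnPath ι.1 (depth ι.2) l x then f ι.1 else 0) =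
      if x l = 0 then N * f l + (2 * N - x (l + 1) : ℕ) * f (l + 1) +
        (2 * N - x (l + 2) : ℕ) * f (l + 2)
      else if x l ≤ 2 * N then f l else 0 := by
  have h1 : l ≠ l + 1 := (add_one_ne l).symm
  have h2 : l ≠ l + 2 := (add_two_ne l).symm
  rw [Fintype.sum_prod_type, sum_fin_three l]
  simp only [OnPath, if_true, if_neg h1, if_neg h2]
  simp only [← Finset.sum_filter, Finset.sum_const, nsmul_eq_mul]
  by_cases h0 : x l = 0
  · simp only [h0, true_and, if_true, eq_comm (a := 0), card_depth_eq_zero, card_lt_depth]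
  · simp only [h0, false_and, if_false, Finset.filter_false, Finset.card_empty, Nat.cast_zero,
      zero_mul, add_zero, eq_comm (a := x l)]
    split_ifs with h
    · rw [card_depth_eq h0 h]; simp
    · have : (Finset.univ.filter fun i : Fin N ⊕ Fin (2 * N) => depth i = x l) = ∅ := by
        ext i
        have := depth_le i
        simp; omega
      rw [this]; simp

/-- What remains of the sum over the paths through an edge after telescoping the potentials is
bounded below by a sum with coefficients that do not depend on `N`. -/
theorem le_sum_onPath {N n : ℕ} (hn : n + 1 = 3 * N) (c : (Fin 3 → ℕ) → Fin 3)
    {x : Fin 3 → ℕ} (hx : x ∈ grid n) (l : Fin 3) {a b : Fin 3}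
    (ha : a = fillCorners N c (x + Pi.single (l + 1) 1))
    (hb : b = fillCorners N c (x + Pi.single (l + 2) 1)) :
    6 * descent l a b - orient a b + (if x l = 0 then 2 * orient a b else 0) ≤
      ∑ ι : Fin 3 × (Fin N ⊕ Fin (2 * N)), if OnPath ι.1 (depth ι.2) l x then
        if l = ι.1 then 6 * descent ι.1 a b - orient a b
        else 6 * descent ι.1 b a - orient b a else 0 := by
  have hrw := sum_onPath N l x fun k => if l = k then 6 * descent k a b - orient a b
        else 6 * descent k b a - orient b a
  simp only at hrw
  rw [hrw]
  have h1 : l ≠ l + 1 := (add_one_ne l).symm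
  have h2 : l ≠ l + 2 := (add_two_ne l).symm
  simp only [if_true, if_neg h1, if_neg h2]
  have hsum := sum_eq_of_mem_grid hx l
  have hu : x + Pi.single (l + 1) 1 ∈ grid (3 * N) := hn ▸ add_single_mem_grid hx _
  have hw : x + Pi.single (l + 2) 1 ∈ grid (3 * N) := hn ▸ add_single_mem_grid hx _
  -- A terminal whose corner contains both ends of the edge forces their labels to agree.
  have hsame : ∀ i, 2 * N < x i → a = b := by
    intro i hi
    rw [ha, hb, fillCorners_of_lt hu (i := i), fillCorners_of_lt hw (i := i)] <;>
      simp only [Pi.add_apply] <;> omega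
  have hN : 1 ≤ N := by omega
  split_ifs with h0 h2N
  · have hd := descent_nonneg l a b
    have hd1 := descent_nonneg (l + 1) b a
    have hd2 := descent_nonneg (l + 2) b a
    by_cases hab : a = b
    · subst hab
      simp [orient_self, descent_self]
    · have hx1 : x (l + 1) ≤ 2 * N := not_lt.1 fun h => hab (hsame _ h)
      have hx2 : x (l + 2) ≤ 2 * N := not_lt.1 fun h => hab (hsame _ h)
      -- In the middle third of a side, the paths that traverse an edge backwards outnumber the
      -- `N` paths that traverse it forwards by one.
      have hw : ((2 * N - x (l + 1) : ℕ) : ℤ) + (2 * N - x (l + 2) : ℕ) = N + 1 := by omega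
      rw [orient_swap a b]
      have e0 : (descent l a b : ℤ) ≤ N * descent l a b := by
        have : (1 : ℤ) ≤ N := by exact_mod_cast hN
        nlinarith
      have e1 : 0 ≤ ((2 * N - x (l + 1) : ℕ) : ℤ) * descent (l + 1) b a := by positivity
      have e2 : 0 ≤ ((2 * N - x (l + 2) : ℕ) : ℤ) * descent (l + 2) b a := by positivity
      linear_combination 6 * e0 + 6 * e1 + 6 * e2 - orient a b * hw
  · simp
  · rw [hsame l (by omega)]
    simp [orient_self, descent_self]

theorem mem_grid_of_add_single {n : ℕ} {z : Fin 3 → ℕ} (l : Fin 3)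
    (h : z + Pi.single l 1 ∈ grid (n + 1)) : z ∈ grid n := by
  have h' := sum_eq_of_mem_grid h l
  refine mem_grid.2 ?_
  fin_cases l <;> simp at h' <;> omega

/-- Edges off the side opposite to `l` are indexed by the downward triangles to which they
belong. -/
theorem sum_grid_ne_zero (n : ℕ) (l : Fin 3) (f : (Fin 3 → ℕ) → ℤ) :
    (∑ x ∈ grid (n + 1), if x l = 0 then 0 else f x) =
      ∑ z ∈ grid n, f (z + Pi.single l 1) := by
  simp only [← ite_not (p := _ = 0)]
  rw [← Finset.sum_filter]
  symm
  have hsub : ∀ x ∈ Finset.filter (fun x : Fin 3 → ℕ => ¬ x l = 0) (grid (n + 1)),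
      x - Pi.single l 1 + Pi.single l 1 = x := by
    intro x hx
    have h0 := (Finset.mem_filter.1 hx).2
    refine tsub_add_cancel_of_le fun i => ?_
    by_cases hi : i = l
    · subst hi; simp; omega
    · simp [hi]
  refine Finset.sum_nbij' (fun z => z + Pi.single l 1) (fun x => x - Pi.single l 1)
    ?_ ?_ ?_ hsub ?_
  · intro z hz
    simp only [Finset.mem_filter, Pi.add_apply, Pi.single_eq_same]
    exact ⟨add_single_mem_grid hz l, by omega⟩
  · intro x hx
    refine mem_grid_of_add_single l ?_
    rw [hsub x hx]
    exact (Finset.mem_filter.1 hx).1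
  · intro z _; exact add_tsub_cancel_right z _
  · intro z _; rfl

/-- The sum over all edges splits into non-negative contributions of the upward triangles, the
downward triangles and the edges on the sides. -/
theorem sum_edges_nonneg (n : ℕ) (c : (Fin 3 → ℕ) → Fin 3) :
    0 ≤ ∑ x ∈ grid (n + 1), ∑ l : Fin 3,
      (6 * descent l (c (x + Pi.single (l + 1) 1)) (c (x + Pi.single (l + 2) 1)) -
        orient (c (x + Pi.single (l + 1) 1)) (c (x + Pi.single (l + 2) 1)) +
        (if x l = 0 then
          2 * orient (c (x + Pi.single (l + 1) 1)) (c (x + Pi.single (l + 2) 1)) else 0)) := by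
  set D : (Fin 3 → ℕ) → Fin 3 → ℤ := fun x l =>
    descent l (c (x + Pi.single (l + 1) 1)) (c (x + Pi.single (l + 2) 1)) with hD
  set O : (Fin 3 → ℕ) → Fin 3 → ℤ := fun x l =>
    orient (c (x + Pi.single (l + 1) 1)) (c (x + Pi.single (l + 2) 1)) with hO
  have hup : 0 ≤ ∑ x ∈ grid (n + 1), ∑ l : Fin 3, (3 * D x l + O x l) := by
    refine Finset.sum_nonneg fun x _ => ?_
    simp only [hD, hO]
    have := upward_triangle_nonneg fun i => c (x + Pi.single i 1)
    exact this
  have hdown : 0 ≤ ∑ x ∈ grid (n + 1), ∑ l : Fin 3,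
      (if x l = 0 then 0 else 3 * D x l - 2 * O x l) := by
    rw [Finset.sum_comm]
    rw [Finset.sum_congr rfl fun l _ => sum_grid_ne_zero n l fun x => 3 * D x l - 2 * O x l]
    rw [Finset.sum_comm]
    refine Finset.sum_nonneg fun z _ => ?_
    have := downward_triangle_nonneg fun i =>
      c (z + Pi.single (i + 1) 1 + Pi.single (i + 2) 1)
    refine this.trans_eq ?_
    refine Finset.sum_congr rfl fun l _ => ?_
    simp only [hD, hO, add_two_add_one, add_two_add_two,
      add_one_add_one, add_one_add_two]
    rw [add_right_comm z (Pi.single (l + 2) 1)]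
  have hside : 0 ≤ ∑ x ∈ grid (n + 1), ∑ l : Fin 3, (if x l = 0 then 3 * D x l else 0) := by
    refine Finset.sum_nonneg fun x _ => Finset.sum_nonneg fun l _ => ?_
    have : 0 ≤ D x l := descent_nonneg _ _ _
    split_ifs <;> omega
  refine (add_nonneg (add_nonneg hup hdown) hside).trans_eq ?_
  simp only [← Finset.sum_add_distrib]
  refine Finset.sum_congr rfl fun x _ => Finset.sum_congr rfl fun l _ => ?_
  change _ = 6 * D x l - O x l + if x l = 0 then 2 * O x l else 0
  split_ifs <;> ring

/-- Every labelling of the grid points that is correct at the terminals has weighted number of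
label changes at least `12 N`. -/
theorem le_sum_weight_change {N : ℕ} (hN : 0 < N) {n : ℕ} (hn : n + 1 = 3 * N)
    (c : (Fin 3 → ℕ) → Fin 3) (hc : ∀ i, c (Pi.single i (3 * N)) = i) :
    12 * (N : ℤ) ≤ ∑ x ∈ grid n, ∑ l : Fin 3, (weight N l x : ℤ) *
      change (c (x + Pi.single (l + 1) 1)) (c (x + Pi.single (l + 2) 1)) := by
  rw [← sum_paths_change N hn c]
  refine le_trans ?_ (Finset.sum_le_sum fun ι _ =>
    sum_change_fillCorners_le hN c hc ι.1 (depth_le ι.2))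
  set f := fillCorners N c with hf
  have hpath : ∀ ι : Fin 3 × (Fin N ⊕ Fin (2 * N)),
      3 * (∑ j ∈ Finset.range (3 * N + depth ι.2),
        change (f (pathNode (3 * N) ι.1 (depth ι.2) j))
          (f (pathNode (3 * N) ι.1 (depth ι.2) (j + 1)))) = 4 +
      ∑ j ∈ Finset.range (3 * N + depth ι.2),
        (6 * descent ι.1 (f (pathNode (3 * N) ι.1 (depth ι.2) j))
          (f (pathNode (3 * N) ι.1 (depth ι.2) (j + 1))) -
        orient (f (pathNode (3 * N) ι.1 (depth ι.2) j))
          (f (pathNode (3 * N) ι.1 (depth ι.2) (j + 1)))) := by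
    rintro ⟨l, i⟩
    have hm := depth_le i
    simp only
    rw [Finset.mul_sum, Finset.sum_congr rfl fun j _ => three_mul_change l _ _,
      Finset.sum_add_distrib,
      Finset.sum_range_sub fun j => potential l (f (pathNode (3 * N) l (depth i) j))]
    have h0 : f (pathNode (3 * N) l (depth i) 0) = l + 1 :=
      fillCorners_of_lt (gridPoint_mem_grid l (by omega)) (by simp; omega)
    have h1 : f (pathNode (3 * N) l (depth i) (3 * N + depth i)) = l + 2 :=
      fillCorners_of_lt (gridPoint_mem_grid l (by omega)) (by simp; omega)
    rw [h0, h1]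
    congr 1
    fin_cases l <;> decide
  have htotal : 0 ≤ ∑ ι : Fin 3 × (Fin N ⊕ Fin (2 * N)),
      ∑ j ∈ Finset.range (3 * N + depth ι.2),
        (6 * descent ι.1 (f (pathNode (3 * N) ι.1 (depth ι.2) j))
          (f (pathNode (3 * N) ι.1 (depth ι.2) (j + 1))) -
        orient (f (pathNode (3 * N) ι.1 (depth ι.2) j))
          (f (pathNode (3 * N) ι.1 (depth ι.2) (j + 1)))) := by
    rw [sum_paths N hn fun k u w => 6 * descent k (f u) (f w) - orient (f u) (f w)]
    obtain ⟨n, rfl⟩ : ∃ n', n = n' + 1 := ⟨n - 1, by omega⟩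
    exact (sum_edges_nonneg n f).trans (Finset.sum_le_sum fun x hx =>
      Finset.sum_le_sum fun l _ => le_sum_onPath hn c hx l rfl rfl)
  have hsum := Finset.sum_congr (rfl : (Finset.univ : Finset (Fin 3 × (Fin N ⊕ Fin (2 * N)))) = _)
    fun ι _ => hpath ι
  rw [← Finset.mul_sum, Finset.sum_add_distrib] at hsum
  simp only [Finset.sum_const, Finset.card_univ, Fintype.card_prod, Fintype.card_sum,
    Fintype.card_fin, nsmul_eq_mul, Nat.cast_mul, Nat.cast_add, Nat.cast_ofNat] at hsum
  linarith

/-! ### The edges of `G_N` -/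

/-- The node of `G_N` at a grid point (with a junk value outside the grid). -/
def toNode (N : ℕ) (x : Fin 3 → ℕ) : GridNode N :=
  if h : x ∈ grid (3 * N) then ⟨x, h⟩ else ⟨Pi.single 0 (3 * N), by simp⟩

theorem toNode_val {N : ℕ} {x : Fin 3 → ℕ} (hx : x ∈ grid (3 * N)) : (toNode N x).1 = x := by
  simp only [toNode, dif_pos hx]

theorem toNode_coe {N : ℕ} (v : GridNode N) : toNode N v.1 = v := by
  simp only [toNode, dif_pos v.2]

/-- The edge of `G_N` between `x + e (l + 1)` and `x + e (l + 2)`. -/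
def gridEdge (N : ℕ) (l : Fin 3) (x : Fin 3 → ℕ) : Sym2 (GridNode N) :=
  s(toNode N (x + Pi.single (l + 1) 1), toNode N (x + Pi.single (l + 2) 1))

theorem gridPos_apply (N : ℕ) (hN : 0 < N) (v : GridNode N) (i : Fin 3) :
    gridPos N hN v i = (v.1 i : ℝ) / (3 * N) := rfl

theorem gridPos_mem (N : ℕ) (hN : 0 < N) (v : GridNode N) :
    ⇑(gridPos N hN v) ∈ stdSimplex ℝ (Fin 3) := (gridPos N hN v).2

theorem halfL1_gridPos (N : ℕ) (hN : 0 < N) (u v : GridNode N) :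
    halfL1 (gridPos N hN u) (gridPos N hN v) =
      ((∑ i, |(u.1 i : ℤ) - v.1 i| : ℤ) : ℝ) / 2 / (3 * N) := by
  have hN' : (0 : ℝ) < 3 * N := by positivity
  simp only [halfL1, gridPos_apply, ← sub_div, abs_div, abs_of_pos hN', ← Finset.sum_div]
  push_cast
  ring

theorem lowerBoundGraph_adj {N : ℕ} (hN : 0 < N) {u v : GridNode N} :
    (lowerBoundGraph N hN).graph.Adj u v ↔ ∑ i, |(u.1 i : ℤ) - v.1 i| = 2 := by
  have hN' : (3 * N : ℝ) ≠ 0 := by positivity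
  change halfL1 (gridPos N hN u) (gridPos N hN v) = 1 / (3 * N) ↔ _
  rw [halfL1_gridPos, div_left_inj' hN', div_eq_one_iff_eq two_ne_zero]
  norm_cast

theorem gridEdge_mem_edgeSet {N : ℕ} (hN : 0 < N) {n : ℕ} (hn : n + 1 = 3 * N) (l : Fin 3)
    {x : Fin 3 → ℕ} (hx : x ∈ grid n) :
    gridEdge N l x ∈ (lowerBoundGraph N hN).graph.edgeSet := by
  refine (lowerBoundGraph_adj hN).2 ?_
  rw [toNode_val (hn ▸ add_single_mem_grid hx _), toNode_val (hn ▸ add_single_mem_grid hx _),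
    sum_fin_three l]
  fin_cases l <;> simp

theorem exists_gridEdge_eq {N : ℕ} (hN : 0 < N) {n : ℕ} (hn : n + 1 = 3 * N)
    {u v : GridNode N} (h : (lowerBoundGraph N hN).graph.Adj u v) :
    ∃ l, ∃ x ∈ grid n, gridEdge N l x = s(u, v) := by
  rw [lowerBoundGraph_adj hN, Fin.sum_univ_three] at h
  have hu := mem_grid.1 u.2
  have hv := mem_grid.1 v.2
  have a0 := abs_cases ((u.1 0 : ℤ) - v.1 0)
  have a1 := abs_cases ((u.1 1 : ℤ) - v.1 1)
  have a2 := abs_cases ((u.1 2 : ℤ) - v.1 2)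
  have key : ∀ u v : GridNode N, ∀ l, u.1 l = v.1 l → u.1 (l + 1) = v.1 (l + 1) + 1 →
      ∃ l, ∃ x ∈ grid n, gridEdge N l x = s(u, v) := by
    intro u v l h0 h1
    have hu := sum_eq_of_mem_grid u.2 l
    have hv := sum_eq_of_mem_grid v.2 l
    have eu : gridPoint n l (u.1 l) (u.1 (l + 2)) + Pi.single (l + 1) 1 = u.1 := by
      rw [gridPoint_add_single_add_one l (by omega), hn, gridPoint_of_mem_grid u.2]
    have ev : gridPoint n l (u.1 l) (u.1 (l + 2)) + Pi.single (l + 2) 1 = v.1 := by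
      rw [gridPoint_add_single_add_two, hn, h0, show u.1 (l + 2) + 1 = v.1 (l + 2) by omega,
        gridPoint_of_mem_grid v.2]
    exact ⟨l, _, gridPoint_mem_grid l (m := u.1 l) (a := u.1 (l + 2)) (by omega), by
      rw [gridEdge, eu, ev, toNode_coe, toNode_coe]⟩
  have hcases : ∃ l, u.1 l = v.1 l ∧
      (u.1 (l + 1) = v.1 (l + 1) + 1 ∨ v.1 (l + 1) = u.1 (l + 1) + 1) := by
    by_cases h0 : u.1 0 = v.1 0
    · exact ⟨0, h0, by simp; omega⟩
    by_cases h1 : u.1 1 = v.1 1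
    · exact ⟨1, h1, by simp; omega⟩
    · exact ⟨2, by omega, by simp; omega⟩
  obtain ⟨l, h0, h1 | h1⟩ := hcases
  · exact key u v l h0 h1
  · rw [Sym2.eq_swap]
    exact key v u l h0.symm h1

theorem gridEdge_injective {N : ℕ} {n : ℕ} (hn : n + 1 = 3 * N) {l l' : Fin 3}
    {x x' : Fin 3 → ℕ} (hx : x ∈ grid n) (hx' : x' ∈ grid n)
    (h : gridEdge N l x = gridEdge N l' x') : l = l' ∧ x = x' := by
  have hs := mem_grid.1 hx
  have hs' := mem_grid.1 hx'
  have hcases : (x + Pi.single (l + 1) 1 = x' + Pi.single (l' + 1) 1 ∧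
      x + Pi.single (l + 2) 1 = x' + Pi.single (l' + 2) 1) ∨
      (x + Pi.single (l + 1) 1 = x' + Pi.single (l' + 2) 1 ∧
      x + Pi.single (l + 2) 1 = x' + Pi.single (l' + 1) 1) := by
    rw [gridEdge, gridEdge, Sym2.eq_iff] at h
    simpa only [← Subtype.val_inj, toNode_val (hn ▸ add_single_mem_grid hx _),
      toNode_val (hn ▸ add_single_mem_grid hx' _)] using h
  have hx3 : l = l' → x 0 = x' 0 → x 1 = x' 1 → x 2 = x' 2 → l = l' ∧ x = x' :=
    fun hl h0 h1 h2 => ⟨hl, ext_fin_three 0 h0 h1 h2⟩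
  rcases hcases with ⟨h1, h2⟩ | ⟨h1, h2⟩ <;>
  · have a0 := congrFun h1 0
    have a1 := congrFun h1 1
    have a2 := congrFun h1 2
    have b0 := congrFun h2 0
    have b1 := congrFun h2 1
    have b2 := congrFun h2 2
    fin_cases l <;> fin_cases l' <;> simp at a0 a1 a2 b0 b1 b2 <;>
      first | omega | (apply hx3 <;> first | rfl | omega)

theorem sum_edges {N : ℕ} (hN : 0 < N) {n : ℕ} (hn : n + 1 = 3 * N)
    [Fintype (lowerBoundGraph N hN).graph.edgeSet] (f : Sym2 (lowerBoundGraph N hN).V → ℝ) :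
    ∑ e ∈ (lowerBoundGraph N hN).graph.edgeFinset, f e =
      ∑ x ∈ grid n, ∑ l, f (gridEdge N l x) := by
  rw [← Finset.sum_product']
  symm
  refine Finset.sum_bij (fun p _ => gridEdge N p.2 p.1) ?_ ?_ ?_ fun _ _ => rfl
  · intro p hp
    refine SimpleGraph.mem_edgeFinset.2 ?_
    exact gridEdge_mem_edgeSet hN hn p.2 (Finset.mem_product.1 hp).1
  · intro p hp q hq h
    have := gridEdge_injective hn (Finset.mem_product.1 hp).1 (Finset.mem_product.1 hq).1 h
    exact Prod.ext this.2 this.1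
  · intro e he
    rw [SimpleGraph.mem_edgeFinset] at he
    induction e with
    | _ u v =>
      obtain ⟨l, x, hx, h⟩ := exists_gridEdge_eq hN hn he
      exact ⟨(x, l), by simpa using hx, h⟩

/-! ### The costs of the edges of `G_N` -/

theorem mem_path_iff (k : Fin 3) {d : ℝ} (h0 : 0 ≤ d) (h1 : d < 1) {p : Fin 3 → ℝ}
    (hp : p ∈ stdSimplex ℝ (Fin 3)) :
    p ∈ path (k + 1) (k + 2) k d ↔ p k = d ∨ p k ≤ d ∧ (p (k + 1) = 0 ∨ p (k + 2) = 0) := by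
  have hsum : p k + p (k + 1) + p (k + 2) = 1 := by rw [← sum_fin_three]; exact hp.2
  have hk := hp.1 k
  have hk1 := hp.1 (k + 1)
  have hk2 := hp.1 (k + 2)
  have hext : ∀ q : Fin 3 → ℝ, q = p ↔ q k = p k ∧ q (k + 1) = p (k + 1) ∧
      q (k + 2) = p (k + 2) := by
    intro q
    refine ⟨fun h => by simp [h], fun ⟨a, b, c⟩ => funext fun i => ?_⟩
    rcases eq_or_eq_or_eq k i with rfl | rfl | rfl <;> assumption
  simp only [path, segment_eq_image_lineMap, Set.mem_union, Set.mem_image, hext, Set.mem_Icc,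
    AffineMap.lineMap_apply_module, Pi.add_apply, Pi.smul_apply, smul_eq_mul, Pi.single_apply,
    add_one_ne, add_two_ne, (add_one_ne _).symm, (add_two_ne _).symm, add_one_ne_add_two,
    (add_one_ne_add_two _).symm, if_true, if_false]
  constructor
  · rintro ((⟨t, ⟨ht0, ht1⟩, e0, e1, e2⟩ | ⟨t, ⟨ht0, ht1⟩, e0, e1, e2⟩) |
      ⟨t, ⟨ht0, ht1⟩, e0, e1, e2⟩)
    · exact Or.inr ⟨by nlinarith, Or.inr (by linarith)⟩
    · exact Or.inl (by linarith)
    · exact Or.inr ⟨by nlinarith, Or.inl (by linarith)⟩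
  · rintro (h | ⟨h, h' | h'⟩)
    · have : 0 < 1 - d := by linarith
      refine Or.inl (Or.inr ⟨p (k + 2) / (1 - d), ⟨by positivity, ?_⟩, ?_, ?_, ?_⟩)
      · rw [div_le_one this]; linarith
      · field_simp; linear_combination (-(1 - d)) * h
      · field_simp; linear_combination (-(1 - d)) * hsum + (1 - d) * h
      · field_simp; linarith
    · refine Or.inr ?_
      rcases h0.eq_or_lt with rfl | hd
      · exact ⟨0, ⟨le_rfl, zero_le_one⟩, by linarith, by linarith, by linarith⟩
      · refine ⟨1 - p k / d, ⟨?_, ?_⟩, ?_, ?_, ?_⟩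
        · rw [sub_nonneg, div_le_one hd]; exact h
        · have : 0 ≤ p k / d := by positivity
          linarith
        · field_simp; linarith
        · field_simp; linear_combination (-d) * h'
        · field_simp; linear_combination (-d) * hsum + d * h'
    · refine Or.inl (Or.inl ?_)
      rcases h0.eq_or_lt with rfl | hd
      · exact ⟨0, ⟨le_rfl, zero_le_one⟩, by linarith, by linarith, by linarith⟩
      · refine ⟨p k / d, ⟨by positivity, ?_⟩, ?_, ?_, ?_⟩
        · rw [div_le_one hd]; exact h
        · field_simp; linarith
        · field_simp; linear_combination (-d) * hsum + d * h'
        · field_simp; linear_combination (-d) * h'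

theorem pathFamily_eq (N : ℕ) (ι : Fin 3 × (Fin N ⊕ Fin (2 * N))) :
    pathFamily N ι = path (ι.1 + 1) (ι.1 + 2) ι.1 ((depth ι.2 : ℝ) / (3 * N)) := by
  rcases ι with ⟨l, i | i⟩ <;> simp [pathFamily]

theorem gridPos_mem_pathFamily {N : ℕ} (hN : 0 < N) (ι : Fin 3 × (Fin N ⊕ Fin (2 * N)))
    (v : GridNode N) :
    ⇑(gridPos N hN v) ∈ pathFamily N ι ↔ v.1 ι.1 = depth ι.2 ∨
      v.1 ι.1 ≤ depth ι.2 ∧ (v.1 (ι.1 + 1) = 0 ∨ v.1 (ι.1 + 2) = 0) := by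
  have hN' : (0 : ℝ) < 3 * N := by positivity
  have hd := depth_le ι.2
  rw [pathFamily_eq, mem_path_iff ι.1 (by positivity)
    (by rw [div_lt_one hN']; norm_cast; omega) (gridPos_mem N hN v)]
  simp only [gridPos_apply, div_left_inj' hN'.ne', div_le_div_iff_of_pos_right hN', div_eq_zero_iff,
    hN'.ne', or_false, Nat.cast_inj, Nat.cast_le, Nat.cast_eq_zero]

theorem cost_gridEdge {N : ℕ} (hN : 0 < N) {n : ℕ} (hn : n + 1 = 3 * N) (l : Fin 3)
    {x : Fin 3 → ℕ} (hx : x ∈ grid n) :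
    (lowerBoundGraph N hN).cost (gridEdge N l x) = weight N l x := by
  simp only [lowerBoundGraph, weight, Nat.cast_inj]
  congr 1
  ext ι
  have hs := mem_grid.1 hx
  have hd := depth_le ι.2
  simp only [Finset.mem_filter, Finset.mem_univ, true_and, gridPos_mem_pathFamily, gridEdge,
    Sym2.mem_iff, forall_eq_or_imp, forall_eq, toNode_val (hn ▸ add_single_mem_grid hx _)]
  rcases ι with ⟨k, i⟩
  simp only at hd ⊢
  generalize depth i = m at hd
  fin_cases k <;> fin_cases l <;> simp [OnPath] <;> omega

theorem length_gridEdge {N : ℕ} (hN : 0 < N) {n : ℕ} (hn : n + 1 = 3 * N) (l : Fin 3)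
    {x : Fin 3 → ℕ} (hx : x ∈ grid n) :
    (lowerBoundEmbedding N hN).length (gridEdge N l x) = 1 / (3 * N) :=
  gridEdge_mem_edgeSet hN hn l hx

/-! ### The volume of `G_N` and its cuts -/

theorem sum_weight {N n : ℕ} (hn : n + 1 = 3 * N) :
    ∑ x ∈ grid n, ∑ l, (weight N l x : ℤ) = 3 * N * (11 * N + 1) := by
  have h := sum_paths N hn fun _ _ _ => 1
  have hw : ∀ x l, (weight N l x : ℤ) = ∑ ι : Fin 3 × (Fin N ⊕ Fin (2 * N)),
      if OnPath ι.1 (depth ι.2) l x then if l = ι.1 then 1 else 1 else 0 := by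
    intro x l
    simp only [weight, Finset.card_filter, Nat.cast_sum, Nat.cast_ite, Nat.cast_one, Nat.cast_zero,
      ite_self]
  simp only [hw]
  rw [← h, Fintype.sum_prod_type]
  have hg : ∀ K : ℕ, ∑ m : Fin K, ((m : ℕ) : ℤ) * 2 = K * (K - 1) := by
    intro K
    induction K with
    | zero => simp
    | succ K ih => rw [Fin.sum_univ_castSucc]; simp [ih]; ring
  have h2 := hg (2 * N)
  rw [← Finset.sum_mul] at h2
  simp [Fintype.sum_sum_type, Finset.sum_add_distrib] at h2 ⊢
  refine mul_left_cancel₀ (two_ne_zero (α := ℤ)) ?_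
  linear_combination 3 * h2

open Classical in
theorem volume_lowerBoundEmbedding (N : ℕ) (hN : 0 < N) :
    (lowerBoundEmbedding N hN).volume = 11 * N + 1 := by
  obtain ⟨n, hn⟩ : ∃ n, n + 1 = 3 * N := ⟨3 * N - 1, by omega⟩
  have hN' : (3 * N : ℝ) ≠ 0 := by positivity
  rw [Instance.Embedding.volume]
  refine (sum_edges hN hn _).trans ?_
  rw [Finset.sum_congr rfl fun x hx => Finset.sum_congr rfl fun l _ => by
    rw [cost_gridEdge hN hn l hx, length_gridEdge hN hn l hx]]
  have h := congrArg (Int.cast : ℤ → ℝ) (sum_weight hn)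
  push_cast at h
  simp only [← Finset.sum_mul, h]
  field_simp

/-- A labelling of the nodes that is correct at the terminals has weighted number of edges with
different labels at the ends at least `12 N`. -/
theorem le_sum_of_labelling {N : ℕ} (hN : 0 < N) {n : ℕ} (hn : n + 1 = 3 * N)
    (c : GridNode N → Fin 3) (hc : ∀ i, c ((lowerBoundGraph N hN).terminal i) = i) :
    12 * (N : ℝ) ≤ ∑ x ∈ grid n, ∑ l, (weight N l x : ℝ) *
      if c (toNode N (x + Pi.single (l + 1) 1)) = c (toNode N (x + Pi.single (l + 2) 1))
        then 0 else 1 := by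
  have h := le_sum_weight_change hN hn (fun x => c (toNode N x)) fun i => by
    conv_rhs => rw [← hc i]
    exact congrArg c (toNode_coe ((lowerBoundGraph N hN).terminal i))
  simp only [change] at h
  exact_mod_cast h

open Classical in
theorem le_cutCost {N : ℕ} (hN : 0 < N) {C : Finset (Sym2 (lowerBoundGraph N hN).V)}
    (hC : (lowerBoundGraph N hN).IsCut C) :
    12 * (N : ℝ) ≤ (lowerBoundGraph N hN).cutCost C := by
  obtain ⟨n, hn⟩ : ∃ n, n + 1 = 3 * N := ⟨3 * N - 1, by omega⟩
  obtain ⟨hsub, hsep⟩ := hC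
  have hcost : (lowerBoundGraph N hN).cutCost C =
      ∑ e ∈ (lowerBoundGraph N hN).graph.edgeFinset,
        if e ∈ C then (lowerBoundGraph N hN).cost e else 0 := by
    rw [← Finset.sum_filter, Instance.cutCost]
    refine Finset.sum_congr ?_ fun _ _ => rfl
    ext e
    rw [Finset.mem_filter, SimpleGraph.mem_edgeFinset]
    exact ⟨fun h => ⟨hsub h, h⟩, And.right⟩
  rw [hcost, sum_edges hN hn]
  set H := (lowerBoundGraph N hN).graph.deleteEdges (C : Set (Sym2 (lowerBoundGraph N hN).V))
    with hH
  -- Label a node by the terminal to which it remains connected, if there is one.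
  let pick : (Fin 3 → Prop) → Fin 3 := fun p => if h : ∃ i, p i then h.choose else 0
  let c : (lowerBoundGraph N hN).V → Fin 3 := fun v =>
    pick fun i => H.Reachable ((lowerBoundGraph N hN).terminal i) v
  have hc : ∀ i, c ((lowerBoundGraph N hN).terminal i) = i := by
    intro i
    have h : ∃ j, H.Reachable ((lowerBoundGraph N hN).terminal j)
      ((lowerBoundGraph N hN).terminal i) := ⟨i, .refl _⟩
    simp only [c, pick, dif_pos h]
    by_contra hne
    exact hsep _ _ hne h.choose_spec
  have hadj : ∀ u v, H.Adj u v → c u = c v := by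
    intro u v huv
    exact congrArg pick <| funext fun i =>
      propext ⟨fun h => h.trans huv.reachable, fun h => h.trans huv.symm.reachable⟩
  refine (le_sum_of_labelling hN hn c hc).trans ?_
  refine Finset.sum_le_sum fun x hx => Finset.sum_le_sum fun l _ => ?_
  have hedge := gridEdge_mem_edgeSet hN hn l hx
  split_ifs with h1 h2 h2
  · rw [mul_zero]; exact (lowerBoundGraph N hN).cost_nonneg _
  · rw [mul_zero]
  · rw [mul_one, cost_gridEdge hN hn l hx]
  · exact absurd (hadj _ _ ((SimpleGraph.deleteEdges_adj).2 ⟨hedge, h2⟩)) h1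

/-! ### The drawing of `G_N` has no crossings -/

theorem eq_toNode {N : ℕ} {w : GridNode N} {x : Fin 3 → ℕ} (h : w.1 = x) : w = toNode N x := by
  rw [← h, toNode_coe]

/-- The points on an edge of `G_N`, in coordinates scaled by `3 N`: one coordinate is an integer,
and the fractional parts of the two others add up to `1`. -/
theorem exists_of_mem_segment {N : ℕ} (hN : 0 < N) {n : ℕ} (hn : n + 1 = 3 * N)
    {u v : GridNode N} (h : (lowerBoundGraph N hN).graph.Adj u v) {p : Fin 3 → ℝ}
    (hp : p ∈ segment ℝ ⇑(gridPos N hN u) ⇑(gridPos N hN v)) :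
    ∃ l, ∃ x ∈ grid n, gridEdge N l x = s(u, v) ∧ ∃ s : ℝ, 0 ≤ s ∧ s ≤ 1 ∧
      3 * N * p l = x l ∧ 3 * N * p (l + 1) = x (l + 1) + s ∧
      3 * N * p (l + 2) = x (l + 2) + (1 - s) := by
  have key : ∀ u v : GridNode N, ∀ t : ℝ, 0 ≤ t → t ≤ 1 →
      p = AffineMap.lineMap ⇑(gridPos N hN u) ⇑(gridPos N hN v) t → ∀ l, ∀ x ∈ grid n,
      u = toNode N (x + Pi.single (l + 1) 1) → v = toNode N (x + Pi.single (l + 2) 1) →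
      ∃ s : ℝ, 0 ≤ s ∧ s ≤ 1 ∧
      3 * N * p l = x l ∧ 3 * N * p (l + 1) = x (l + 1) + s ∧
      3 * N * p (l + 2) = x (l + 2) + (1 - s) := by
    intro u v t h0 h1 hp l x hx hu hv
    have hN' : (3 * N : ℝ) ≠ 0 := by positivity
    have hu' : u.1 = x + Pi.single (l + 1) 1 := by
      rw [hu]; exact toNode_val (hn ▸ add_single_mem_grid hx _)
    have hv' : v.1 = x + Pi.single (l + 2) 1 := by
      rw [hv]; exact toNode_val (hn ▸ add_single_mem_grid hx _)
    have hval : ∀ i, 3 * N * p i = (1 - t) * u.1 i + t * v.1 i := by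
      intro i
      rw [hp, AffineMap.lineMap_apply_module]
      simp only [Pi.add_apply, Pi.smul_apply, smul_eq_mul, gridPos_apply]
      field_simp
    refine ⟨1 - t, by linarith, by linarith, ?_, ?_, ?_⟩ <;> rw [hval, hu', hv'] <;>
      simp [(add_one_ne _).symm, (add_two_ne _).symm, (add_one_ne_add_two _).symm] <;> ring
  obtain ⟨l, x, hx, he⟩ := exists_gridEdge_eq hN hn h
  refine ⟨l, x, hx, he, ?_⟩
  rw [segment_eq_image_lineMap] at hp
  obtain ⟨t, ⟨h0, h1⟩, rfl⟩ := hp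
  rw [gridEdge, Sym2.eq_iff] at he
  rcases he with ⟨hu, hv⟩ | ⟨hv, hu⟩
  · exact key u v t h0 h1 rfl l x hx hu.symm hv.symm
  · exact key v u (1 - t) (by linarith) (by linarith) (AffineMap.lineMap_apply_one_sub _ _ _).symm
      l x hx hv.symm hu.symm

theorem gridPos_injective {N : ℕ} (hN : 0 < N) : Function.Injective (gridPos N hN) := by
  intro u v h
  have hN' : (3 * N : ℝ) ≠ 0 := by positivity
  refine Subtype.ext (funext fun i => ?_)
  have hi : gridPos N hN u i = gridPos N hN v i := by rw [h]
  rwa [gridPos_apply, gridPos_apply, div_left_inj' hN', Nat.cast_inj] at hi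

/-- An edge passes through no nodes other than its ends. -/
theorem eq_or_eq_of_mem_segment {N : ℕ} (hN : 0 < N) {u v w : GridNode N}
    (h : (lowerBoundGraph N hN).graph.Adj u v)
    (hw : ⇑(gridPos N hN w) ∈ segment ℝ ⇑(gridPos N hN u) ⇑(gridPos N hN v)) :
    w = u ∨ w = v := by
  obtain ⟨n, hn⟩ : ∃ n, n + 1 = 3 * N := ⟨3 * N - 1, by omega⟩
  obtain ⟨l, x, hx, he, s, hs0, hs1, e0, e1, e2⟩ := exists_of_mem_segment hN hn h hw
  have hN' : (3 * N : ℝ) ≠ 0 := by positivity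
  simp only [gridPos_apply, mul_div_cancel₀ _ hN'] at e0 e1 e2
  have hl : w.1 l = x l := by exact_mod_cast e0
  have hge : x (l + 1) ≤ w.1 (l + 1) := by
    have : (x (l + 1) : ℝ) ≤ w.1 (l + 1) := by linarith
    exact_mod_cast this
  have hle : w.1 (l + 1) ≤ x (l + 1) + 1 := by
    have : (w.1 (l + 1) : ℝ) ≤ x (l + 1) + 1 := by linarith
    exact_mod_cast this
  have hsw := sum_eq_of_mem_grid w.2 l
  have hsx := sum_eq_of_mem_grid hx l
  rw [← Sym2.mem_iff, ← he, gridEdge, Sym2.mem_iff]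
  rcases (by omega : w.1 (l + 1) = x (l + 1) + 1 ∨ w.1 (l + 1) = x (l + 1)) with h1 | h1
  · refine Or.inl (eq_toNode (ext_fin_three l ?_ ?_ ?_)) <;>
      simp [(add_one_ne _).symm, (add_one_ne_add_two _).symm] <;> omega
  · refine Or.inr (eq_toNode (ext_fin_three l ?_ ?_ ?_)) <;>
      simp [(add_two_ne _).symm] <;> omega

theorem natCast_ne_add {a b : ℕ} {s : ℝ} (h0 : 0 < s) (h1 : s < 1) : (a : ℝ) ≠ b + s := by
  intro h
  have hlt : (b : ℝ) < a := by linarith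
  have hlt' : (a : ℝ) < b + 1 := by linarith
  norm_cast at hlt hlt'
  omega

theorem isPlane_lowerBoundEmbedding (N : ℕ) (hN : 0 < N) :
    (lowerBoundEmbedding N hN).IsPlane := by
  refine ⟨gridPos_injective hN, fun u v w huv hw => eq_or_eq_of_mem_segment hN huv hw, ?_⟩
  rintro u v u' v' huv huv' hne p ⟨hp, hp'⟩
  obtain ⟨n, hn⟩ : ∃ n, n + 1 = 3 * N := ⟨3 * N - 1, by omega⟩
  -- It suffices that `p` is an end of the first edge.
  suffices h : ∃ w, (w = u ∨ w = v) ∧ p = gridPos N hN w by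
    obtain ⟨w, hw, rfl⟩ := h
    exact ⟨w, hw, eq_or_eq_of_mem_segment hN huv' hp', rfl⟩
  by_contra hcon
  obtain ⟨l, x, hx, he, s, hs0, hs1, e0, e1, e2⟩ := exists_of_mem_segment hN hn huv hp
  obtain ⟨l', x', hx', he', s', hs0', hs1', e0', e1', e2'⟩ := exists_of_mem_segment hN hn huv' hp'
  have hN' : (3 * N : ℝ) ≠ 0 := by positivity
  have hend : ∀ k : Fin 3, k ≠ l → (∀ i, 3 * N * p i = x i + if i = k then 1 else 0) → False := by
    intro k hk hpk
    refine hcon ⟨toNode N (x + Pi.single k 1), ?_, ?_⟩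
    · suffices h : toNode N (x + Pi.single k 1) ∈ gridEdge N l x by
        rw [he] at h
        exact Sym2.mem_iff.1 h
      rw [gridEdge, Sym2.mem_iff]
      rcases eq_or_eq_or_eq l k with rfl | rfl | rfl
      · exact absurd rfl hk
      · exact Or.inl rfl
      · exact Or.inr rfl
    · funext i
      rw [gridPos_apply, toNode_val (hn ▸ add_single_mem_grid hx _), eq_div_iff hN', mul_comm,
        hpk]
      simp [Pi.single_apply]
  have hs0 : 0 < s := by
    refine lt_of_le_of_ne hs0 fun h => hend (l + 2) (add_two_ne l) fun i => ?_
    rcases eq_or_eq_or_eq l i with rfl | rfl | rfl <;>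
      simp [(add_two_ne _).symm] <;> linarith
  have hs1 : s < 1 := by
    refine lt_of_le_of_ne hs1 fun h => hend (l + 1) (add_one_ne l) fun i => ?_
    rcases eq_or_eq_or_eq l i with rfl | rfl | rfl <;>
      simp [(add_one_ne _).symm, (add_one_ne_add_two _).symm] <;> linarith
  -- Only the coordinate `l` of the scaled point is an integer, which forces `l'` to be `l`, and
  -- the integer parts of the others determine the edge.
  rcases eq_or_eq_or_eq l l' with rfl | rfl | rfl
  · have h1 : x (l' + 1) = x' (l' + 1) := by
      have hlt : (x (l' + 1) : ℝ) < x' (l' + 1) + 1 := by linarith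
      have hlt' : (x' (l' + 1) : ℝ) < x (l' + 1) + 1 := by linarith
      norm_cast at hlt hlt'
      omega
    have h0 : x l' = x' l' := by
      have : (x l' : ℝ) = x' l' := by linarith
      exact_mod_cast this
    have hsx := sum_eq_of_mem_grid hx l'
    have hsx' := sum_eq_of_mem_grid hx' l'
    rw [ext_fin_three l' h0 h1 (by omega)] at he
    exact hne (he.symm.trans he')
  · exact natCast_ne_add hs0 hs1 (e0'.symm.trans e1)
  · exact natCast_ne_add (s := 1 - s) (by linarith) (by linarith) (e0'.symm.trans e2)

/-! ### Lower bounds for cutting schemes -/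

theorem measurableSet_separated {k : ℕ} (p q : stdSimplex ℝ (Fin k)) :
    MeasurableSet {c : SimplexCut k | c.1 p ≠ c.1 q} := by
  have hm : ∀ p, Measurable fun c : SimplexCut k => c.1 p := fun p =>
    (measurable_pi_apply p).comp measurable_subtype_coe
  exact (measurableSet_eq_fun (hm p) (hm q)).compl

theorem one_le_numCuts {k : ℕ} {c : SimplexCut k} {p q : stdSimplex ℝ (Fin k)}
    (h : c.1 p ≠ c.1 q) : 1 ≤ numCuts c p q := by
  have h0 : segPoint p q 0 = p := Subtype.ext (by simp [segPoint]; rfl)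
  have h1 : segPoint p q 1 = q := Subtype.ext (by simp [segPoint]; rfl)
  refine le_trans ?_ (le_iSup_of_le 1 <| le_iSup_of_le ![0, 1] <| le_iSup_of_le ?_ le_rfl)
  · rw [Nat.one_le_cast, Nat.one_le_iff_ne_zero, ← Nat.pos_iff_ne_zero, Finset.card_pos]
    refine ⟨0, Finset.mem_filter.2 ⟨Finset.mem_univ _, ?_⟩⟩
    change c.1 (segPoint p q 0) ≠ c.1 (segPoint p q 1)
    rwa [h0, h1]
  · intro i j hij
    fin_cases i <;> fin_cases j <;> simp at hij ⊢

theorem maxSeparationDensity_le_maxDensity {k : ℕ} (P : CuttingScheme k) :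
    maxSeparationDensity P ≤ maxDensity P := by
  refine iSup₂_mono fun p q => iSup_mono fun _ => ENNReal.div_le_div_right ?_ _
  rw [← lintegral_indicator_one (measurableSet_separated p q)]
  refine lintegral_mono fun c => ?_
  by_cases h : c.1 p = c.1 q
  · simp [Set.indicator, h]
  · have : ((1 : ℕ∞) : ℝ≥0∞) ≤ numCuts c p q := ENat.toENNReal_le.2 (one_le_numCuts h)
    simpa [Set.indicator, h] using this

theorem measure_separated_le {k : ℕ} (P : CuttingScheme k) {p q : stdSimplex ℝ (Fin k)}
    (h : 0 < halfL1 p q) :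
    (P : Measure (SimplexCut k)) {c | c.1 p ≠ c.1 q} ≤
      maxSeparationDensity P * ENNReal.ofReal (halfL1 p q) := by
  have hne : p ≠ q := by
    rintro rfl
    simp [halfL1] at h
  rw [← ENNReal.div_le_iff (by simpa using h) ENNReal.ofReal_ne_top]
  exact le_iSup_of_le p <| le_iSup_of_le q <| le_iSup_of_le hne le_rfl

/-- The expectation of the lower bound on cuts of `G_N`, for the cut of `G_N` that a random cut of
the simplex induces. -/
theorem le_maxSeparationDensity_mul (P : CuttingScheme 3) {N : ℕ} (hN : 0 < N) :
    ENNReal.ofReal (12 * N) ≤ maxSeparationDensity P * ENNReal.ofReal (11 * N + 1) := by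
  obtain ⟨n, hn⟩ : ∃ n, n + 1 = 3 * N := ⟨3 * N - 1, by omega⟩
  set pos : (Fin 3 → ℕ) → stdSimplex ℝ (Fin 3) := fun x => gridPos N hN (toNode N x) with hpos
  set S : (Fin 3 → ℕ) → Fin 3 → Set (SimplexCut 3) := fun x l =>
    {c | c.1 (pos (x + Pi.single (l + 1) 1)) ≠ c.1 (pos (x + Pi.single (l + 2) 1))} with hS
  have hcut : ∀ c : SimplexCut 3, ENNReal.ofReal (12 * N) ≤
      ∑ x ∈ grid n, ∑ l, (weight N l x : ℝ≥0∞) * (S x l).indicator 1 c := by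
    intro c
    have h := le_sum_of_labelling hN hn (fun v => c.1 (gridPos N hN v)) fun i =>
      (congrArg c.1 ((lowerBoundEmbedding N hN).pos_terminal i)).trans (c.2 i)
    refine (ENNReal.ofReal_le_ofReal h).trans_eq ?_
    rw [ENNReal.ofReal_sum_of_nonneg fun x _ => Finset.sum_nonneg fun l _ => by positivity]
    refine Finset.sum_congr rfl fun x _ => ?_
    rw [ENNReal.ofReal_sum_of_nonneg fun l _ => by positivity]
    refine Finset.sum_congr rfl fun l _ => ?_
    rw [ENNReal.ofReal_mul (Nat.cast_nonneg _), ENNReal.ofReal_natCast]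
    congr 1
    by_cases h : c.1 (pos (x + Pi.single (l + 1) 1)) = c.1 (pos (x + Pi.single (l + 2) 1))
    · rw [if_pos h, Set.indicator_of_notMem (by simpa [hS] using h), ENNReal.ofReal_zero]
    · rw [if_neg h, Set.indicator_of_mem (by simpa [hS] using h), ENNReal.ofReal_one]; rfl
  have hlen : ∀ x ∈ grid n, ∀ l,
      halfL1 (pos (x + Pi.single (l + 1) 1)) (pos (x + Pi.single (l + 2) 1)) = 1 / (3 * N) :=
    fun x hx l => length_gridEdge hN hn l hx
  have hN' : (0 : ℝ) < 1 / (3 * N) := by positivity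
  have hvol : ∑ x ∈ grid n, ∑ l, (weight N l x : ℝ≥0∞) * ENNReal.ofReal (1 / (3 * N)) =
      ENNReal.ofReal (11 * N + 1) := by
    have h := congrArg (Int.cast : ℤ → ℝ) (sum_weight hn)
    push_cast at h
    have h' : (11 * N + 1 : ℝ) = (∑ x ∈ grid n, ∑ l, (weight N l x : ℝ)) * (1 / (3 * N)) := by
      rw [h]; field_simp
    rw [h', ENNReal.ofReal_mul (by positivity)]
    simp only [← Finset.sum_mul]
    congr 1
    rw [ENNReal.ofReal_sum_of_nonneg fun x _ => Finset.sum_nonneg fun l _ => by positivity]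
    refine Finset.sum_congr rfl fun x _ => ?_
    rw [ENNReal.ofReal_sum_of_nonneg fun l _ => by positivity]
    simp
  have hmeas : ∀ x l, MeasurableSet (S x l) := fun x l => measurableSet_separated _ _
  calc ENNReal.ofReal (12 * N)
      = ∫⁻ _, ENNReal.ofReal (12 * N) ∂(P : Measure (SimplexCut 3)) := by simp
    _ ≤ ∫⁻ c, ∑ x ∈ grid n, ∑ l, (weight N l x : ℝ≥0∞) * (S x l).indicator 1 c
          ∂(P : Measure (SimplexCut 3)) := lintegral_mono hcut
    _ = ∑ x ∈ grid n, ∑ l, (weight N l x : ℝ≥0∞) * (P : Measure (SimplexCut 3)) (S x l) := by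
        have hm : ∀ x l, Measurable ((S x l).indicator (1 : SimplexCut 3 → ℝ≥0∞)) :=
          fun x l => measurable_one.indicator (hmeas x l)
        rw [lintegral_finsetSum _ fun x _ => Finset.measurable_sum _ fun l _ =>
          (hm x l).const_mul _]
        refine Finset.sum_congr rfl fun x _ => ?_
        rw [lintegral_finsetSum _ fun l _ => (hm x l).const_mul _]
        refine Finset.sum_congr rfl fun l _ => ?_
        rw [lintegral_const_mul _ (hm x l), lintegral_indicator_one (hmeas x l)]
    _ ≤ ∑ x ∈ grid n, ∑ l, maxSeparationDensity P *
          ((weight N l x : ℝ≥0∞) * ENNReal.ofReal (1 / (3 * N))) := by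
        refine Finset.sum_le_sum fun x hx => Finset.sum_le_sum fun l _ => ?_
        rw [mul_left_comm]
        gcongr
        rw [← hlen x hx l]
        exact measure_separated_le P (by rw [hlen x hx l]; exact hN')
    _ = maxSeparationDensity P * ENNReal.ofReal (11 * N + 1) := by
        simp only [← Finset.mul_sum, hvol]

theorem twelve_div_eleven_le {t : ℝ} (h : ∀ N : ℕ, 0 < N → 12 * (N : ℝ) ≤ t * (11 * N + 1)) :
    12 / 11 ≤ t := by
  by_contra! hlt
  have hpos : 0 < 12 - 11 * t := by linarith
  obtain ⟨N, hN⟩ := exists_nat_gt (t / (12 - 11 * t))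
  rw [div_lt_iff₀ hpos] at hN
  have h1 := h (N + 1) N.succ_pos
  push_cast at h1
  linarith

theorem twelve_div_eleven_le_maxSeparationDensity (P : CuttingScheme 3) :
    12 / 11 ≤ maxSeparationDensity P := by
  rcases eq_or_ne (maxSeparationDensity P) ⊤ with htop | htop
  · rw [htop]; exact le_top
  · have hreal : 12 / 11 ≤ (maxSeparationDensity P).toReal := by
      refine twelve_div_eleven_le fun N hN => ?_
      have h := le_maxSeparationDensity_mul P hN
      rw [← ENNReal.ofReal_toReal htop, ← ENNReal.ofReal_mul ENNReal.toReal_nonneg] at h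
      exact (ENNReal.ofReal_le_ofReal_iff (by positivity)).1 h
    rw [← ENNReal.ofReal_toReal htop]
    refine le_trans (le_of_eq ?_) (ENNReal.ofReal_le_ofReal hreal)
    rw [ENNReal.ofReal_div_of_pos (by norm_num)]
    norm_num

/-! ### Rounding an embedding of three terminals -/

/-- `1` if the labels `a` and `b` differ, and `0` otherwise, as a real number. -/
noncomputable def separation (a b : Fin 3) : ℝ := if a = b then 0 else 1

/-- A labelling of the nodes that is correct at the terminals gives a cut. -/
theorem minCutCost_le (G : Instance 3) [Fintype G.graph.edgeSet] {u v : Sym2 G.V → G.V}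
    (huv : ∀ e, s(u e, v e) = e) (g : G.V → Fin 3) (hg : ∀ i, g (G.terminal i) = i) :
    G.minCutCost ≤ ∑ e ∈ G.graph.edgeFinset, G.cost e * separation (g (u e)) (g (v e)) := by
  classical
  set C := G.graph.edgeFinset.filter fun e => g (u e) ≠ g (v e) with hC
  have hadj : ∀ a b, (G.graph.deleteEdges (C : Set (Sym2 G.V))).Adj a b → g a = g b := by
    intro a b hab
    rw [SimpleGraph.deleteEdges_adj] at hab
    have h : g (u s(a, b)) = g (v s(a, b)) := by
      by_contra hne
      exact hab.2 (Finset.mem_coe.2 (Finset.mem_filter.2 ⟨SimpleGraph.mem_edgeFinset.2 hab.1, hne⟩))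
    rcases Sym2.eq_iff.1 (huv s(a, b)) with ⟨h1, h2⟩ | ⟨h1, h2⟩
    · exact (congrArg g h1).symm.trans (h.trans (congrArg g h2))
    · exact (congrArg g h2).symm.trans (h.symm.trans (congrArg g h1))
  have hreach : ∀ a b, (G.graph.deleteEdges (C : Set (Sym2 G.V))).Reachable a b → g a = g b := by
    rintro a b ⟨w⟩
    induction w with
    | nil => rfl
    | cons h _ ih => exact (hadj _ _ h).trans ih
  have hcut : G.IsCut C := by
    refine ⟨fun e he => SimpleGraph.mem_edgeFinset.1 (Finset.mem_filter.1 he).1, ?_⟩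
    intro i j hij h
    exact hij (by rw [← hg i, ← hg j, hreach _ _ h])
  have hbdd : BddBelow {c | ∃ C, G.IsCut C ∧ c = G.cutCost C} :=
    ⟨0, by rintro _ ⟨C, _, rfl⟩; exact Finset.sum_nonneg fun e _ => G.cost_nonneg e⟩
  refine (csInf_le hbdd ⟨C, hcut, rfl⟩).trans_eq ?_
  rw [Instance.cutCost, hC, Finset.sum_filter]
  refine Finset.sum_congr rfl fun e _ => ?_
  by_cases h : g (u e) = g (v e) <;> simp [separation, h]

/-- The block of a point in a cut with a center `q`, in terms of the signs `s i` of the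
differences of the coordinates of the point and of `q`. If exactly one sign is positive, this is
the block of the point. If two are positive, a coin `b l`, where `l` is the negative one,
decides between the two. (The two other combinations of signs do not occur.) -/
def centerBlock (b : Bool × Bool × Bool) (s0 s1 s2 : Bool) : Fin 3 :=
  if s0 then
    if s1 then (if b.2.2 then 0 else 1) else if s2 then (if b.2.1 then 2 else 0) else 0
  else if s1 then (if s2 then (if b.1 then 1 else 2) else 1) else 2

/-- Every change of sign separates with probability at most `1 / 2`. -/
theorem sum_centerBlock_le : ∀ s0 s1 s2 r0 r1 r2 : Bool,
    (s0 || s1 || s2) = true → (s0 && s1 && s2) = false →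
    (r0 || r1 || r2) = true → (r0 && r1 && r2) = false →
    (∑ b : Bool × Bool × Bool,
      if centerBlock b s0 s1 s2 = centerBlock b r0 r1 r2 then 0 else 1) ≤
    4 * ((if s0 = r0 then 0 else 1) + (if s1 = r1 then 0 else 1) +
      (if s2 = r2 then 0 else 1)) := by
  decide

/-- The block of `x` in the cut with center `q` and coins `b`. The tie-breaking ensures that the
three signs are never equal for points of the simplex. -/
noncomputable def centerCut (q : Fin 3 → ℝ) (b : Bool × Bool × Bool) (x : Fin 3 → ℝ) : Fin 3 :=
  centerBlock b (decide (q 0 ≤ x 0)) (decide (q 1 ≤ x 1)) (decide (q 2 < x 2))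

/-- The block of `x` in the cut that slices off the two terminals other than `l` at distance `t`.
-/
noncomputable def cornerCut (l : Fin 3) (t : ℝ) (x : Fin 3 → ℝ) : Fin 3 :=
  if 1 - t < x (l + 1) then l + 1 else if 1 - t < x (l + 2) then l + 2 else l

/-- `1` if `θ` lies between `a` and `b`, and `0` otherwise. -/
noncomputable def between (a b θ : ℝ) : ℝ := (Set.uIcc a b).indicator 1 θ

theorem between_nonneg (a b θ : ℝ) : 0 ≤ between a b θ :=
  Set.indicator_nonneg (fun _ _ => zero_le_one) _

theorem one_le_between {a b θ : ℝ} (h : a ≤ θ ∧ θ ≤ b ∨ b ≤ θ ∧ θ ≤ a) :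
    1 ≤ between a b θ := by
  rw [between, Set.indicator_of_mem (Set.mem_uIcc.2 h)]; rfl

theorem ite_le_between {a b θ : ℝ} {p q : Prop} [Decidable p] [Decidable q]
    (h1 : p → ¬ q → a ≤ θ ∧ θ ≤ b ∨ b ≤ θ ∧ θ ≤ a)
    (h2 : q → ¬ p → a ≤ θ ∧ θ ≤ b ∨ b ≤ θ ∧ θ ≤ a) :
    (if decide p = decide q then (0 : ℝ) else 1) ≤ between a b θ := by
  split_ifs with h
  · exact between_nonneg a b θ
  · refine one_le_between ?_
    rw [decide_eq_decide] at h
    tauto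

theorem sum_centerCut_le {q x y : Fin 3 → ℝ} (hq : q 0 + q 1 + q 2 = 1)
    (hx : x 0 + x 1 + x 2 = 1) (hy : y 0 + y 1 + y 2 = 1) :
    ∑ b, separation (centerCut q b x) (centerCut q b y) ≤
      4 * (between (x 0) (y 0) (q 0) + between (x 1) (y 1) (q 1) + between (x 2) (y 2) (q 2)) := by
  have hor : ∀ z : Fin 3 → ℝ, z 0 + z 1 + z 2 = 1 →
      (decide (q 0 ≤ z 0) || decide (q 1 ≤ z 1) || decide (q 2 < z 2)) = true := by
    intro z hz
    by_contra h
    simp only [Bool.or_eq_true, decide_eq_true_eq, not_or, not_le, not_lt] at h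
    linarith
  have hand : ∀ z : Fin 3 → ℝ, z 0 + z 1 + z 2 = 1 →
      (decide (q 0 ≤ z 0) && decide (q 1 ≤ z 1) && decide (q 2 < z 2)) = false := by
    intro z hz
    by_contra h
    simp only [Bool.not_eq_false, Bool.and_eq_true, decide_eq_true_eq] at h
    linarith
  have h := sum_centerBlock_le _ _ _ _ _ _ (hor x hx) (hand x hx) (hor y hy) (hand y hy)
  rw [← Nat.cast_le (α := ℝ)] at h
  push_cast at h
  refine h.trans ?_
  gcongr
  · exact ite_le_between (fun h1 h2 => Or.inr ⟨(not_le.1 h2).le, h1⟩)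
      fun h1 h2 => Or.inl ⟨(not_le.1 h2).le, h1⟩
  · exact ite_le_between (fun h1 h2 => Or.inr ⟨(not_le.1 h2).le, h1⟩)
      fun h1 h2 => Or.inl ⟨(not_le.1 h2).le, h1⟩
  · exact ite_le_between (fun h1 h2 => Or.inr ⟨not_lt.1 h2, h1.le⟩)
      fun h1 h2 => Or.inl ⟨not_lt.1 h2, h1.le⟩

theorem separation_cornerCut_le (l : Fin 3) (t : ℝ) (x y : Fin 3 → ℝ) :
    separation (cornerCut l t x) (cornerCut l t y) ≤
      between (x (l + 1)) (y (l + 1)) (1 - t) + between (x (l + 2)) (y (l + 2)) (1 - t) := by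
  have n1 := between_nonneg (x (l + 1)) (y (l + 1)) (1 - t)
  have n2 := between_nonneg (x (l + 2)) (y (l + 2)) (1 - t)
  have h1 : ∀ i, (1 - t < x i ∧ ¬ 1 - t < y i) ∨ (1 - t < y i ∧ ¬ 1 - t < x i) →
      1 ≤ between (x i) (y i) (1 - t) := by
    rintro i (h | h)
    · exact one_le_between (Or.inr ⟨not_lt.1 h.2, h.1.le⟩)
    · exact one_le_between (Or.inl ⟨not_lt.1 h.2, h.1.le⟩)
  have h11 := h1 (l + 1)
  have h12 := h1 (l + 2)
  unfold separation cornerCut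
  by_cases a1 : 1 - t < x (l + 1) <;> by_cases a2 : 1 - t < y (l + 1) <;>
    by_cases a3 : 1 - t < x (l + 2) <;> by_cases a4 : 1 - t < y (l + 2) <;>
    simp only [a1, a2, a3, a4, if_true, if_false, not_true, not_false_eq_true, and_true, and_false,
      or_true, or_false, or_self, forall_const] at h11 h12 ⊢ <;>
    first | linarith | (split_ifs <;> linarith)

/-- The centers of the cuts: as `t` ranges over `(0, 1 / 3)` and `σ` over both values, every
coordinate is uniformly distributed in `(0, 2 / 3)`. -/
noncomputable def center (σ : Bool) (t : ℝ) : Fin 3 → ℝ :=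
  if σ then ![t + 1 / 3, t, 2 / 3 - 2 * t] else ![t, t + 1 / 3, 2 / 3 - 2 * t]

/-- A bound on the probability that `x` and `y` are separated, for fixed `t` (scaled by
`11 / 2`). -/
noncomputable def separationBound (x y : Fin 3 → ℝ) (t : ℝ) : ℝ :=
  (between (x 0) (y 0) t + between (x 0) (y 0) (t + 1 / 3) + between (x 0) (y 0) (1 - t)) +
  (between (x 1) (y 1) t + between (x 1) (y 1) (t + 1 / 3) + between (x 1) (y 1) (1 - t)) +
  (2 * between (x 2) (y 2) (2 / 3 - 2 * t) + between (x 2) (y 2) (1 - t))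

theorem sum_separation_le {x y : Fin 3 → ℝ} (hx : x 0 + x 1 + x 2 = 1)
    (hy : y 0 + y 1 + y 2 = 1) (t : ℝ) :
    1 / 22 * (∑ σ, ∑ b, separation (centerCut (center σ t) b x) (centerCut (center σ t) b y)) +
      1 / 11 * (∑ l, separation (cornerCut l t x) (cornerCut l t y)) ≤
    2 / 11 * separationBound x y t := by
  have h1 := sum_centerCut_le (q := center true t) (by simp [center]; ring) hx hy
  have h2 := sum_centerCut_le (q := center false t) (by simp [center]; ring) hx hy
  have c0 := separation_cornerCut_le 0 t x y
  have c1 := separation_cornerCut_le 1 t x y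
  have c2 := separation_cornerCut_le 2 t x y
  rw [Fintype.sum_bool, Fin.sum_univ_three]
  simp [center] at h1 h2 c0 c1 c2 ⊢
  unfold separationBound
  linarith

theorem vertex_apply (i j : Fin 3) :
    (stdSimplex.vertex i : stdSimplex ℝ (Fin 3)) j = if j = i then 1 else 0 := by
  change (Pi.single i 1 : Fin 3 → ℝ) j = _
  rw [Pi.single_apply]

theorem centerCut_vertex (σ : Bool) {t : ℝ} (h0 : 0 < t) (h1 : t < 1 / 3)
    (b : Bool × Bool × Bool) (i : Fin 3) :
    centerCut (center σ t) b ⇑(stdSimplex.vertex i : stdSimplex ℝ (Fin 3)) = i := by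
  have a1 : ¬ t ≤ 0 := by linarith
  have a2 : t ≤ 1 := by linarith
  have a3 : ¬ t + 1 / 3 ≤ 0 := by linarith
  have a4 : t + 1 / 3 ≤ 1 := by linarith
  have a5 : ¬ 2 / 3 - 2 * t < 0 := by linarith
  unfold centerCut
  simp only [vertex_apply]
  cases σ <;> fin_cases i <;>
    simp [center, centerBlock, a1, a2, a3, a4, a5, -one_div, -sub_neg, -not_le, -not_lt]

theorem cornerCut_vertex (l : Fin 3) {t : ℝ} (h0 : 0 < t) (h1 : t < 1 / 3) (i : Fin 3) :
    cornerCut l t ⇑(stdSimplex.vertex i : stdSimplex ℝ (Fin 3)) = i := by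
  have a1 : 1 - t < 1 := by linarith
  have a2 : ¬ 1 - t < 0 := by linarith
  unfold cornerCut
  simp only [vertex_apply]
  rcases eq_or_eq_or_eq l i with rfl | rfl | rfl
  · rw [if_neg (add_one_ne i), if_neg (add_two_ne i), if_neg a2, if_neg a2]
  · rw [if_pos rfl, if_pos a1]
  · rw [if_neg (add_one_ne_add_two l), if_neg a2, if_pos rfl, if_pos a1]

theorem measurable_between (a b : ℝ) : Measurable (between a b) :=
  measurable_one.indicator measurableSet_uIcc

theorem between_le_one (a b θ : ℝ) : between a b θ ≤ 1 :=
  Set.indicator_le_self' (fun _ _ => zero_le_one) θ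

theorem intervalIntegrable_between (a b : ℝ) {f : ℝ → ℝ} (hf : Measurable f) (c d : ℝ) :
    IntervalIntegrable (fun t => between a b (f t)) volume c d := by
  refine (intervalIntegrable_const (c := (1 : ℝ))).mono_fun'
    ((measurable_between a b).comp hf).aestronglyMeasurable (.of_forall fun t => ?_)
  simp only
  rw [Real.norm_of_nonneg (between_nonneg a b _)]
  exact between_le_one a b _

theorem integral_between_le (a b : ℝ) : ∫ θ in (0 : ℝ)..1, between a b θ ≤ |a - b| := by
  rw [intervalIntegral.integral_of_le zero_le_one]
  have hint : Integrable (between a b) volume :=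
    (integrable_indicator_iff measurableSet_uIcc).2
      (integrableOn_const (C := (1 : ℝ)) (by simp [Set.uIcc]))
  refine (setIntegral_le_integral hint (.of_forall (between_nonneg a b))).trans_eq ?_
  unfold between
  rw [integral_indicator_one measurableSet_uIcc, Real.volume_real_interval, abs_sub_comm]

theorem integral_separationBound_le (x y : Fin 3 → ℝ) :
    ∫ t in (0 : ℝ)..1 / 3, separationBound x y t ≤ 2 * halfL1 x y := by
  have hI : ∀ (i : Fin 3) {f : ℝ → ℝ}, Measurable f → ∀ c d,
      IntervalIntegrable (fun t => between (x i) (y i) (f t)) volume c d :=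
    fun i f hf => intervalIntegrable_between _ _ hf
  have m1 : Measurable fun t : ℝ => t := measurable_id
  have m2 : Measurable fun t : ℝ => t + 1 / 3 := by fun_prop
  have m3 : Measurable fun t : ℝ => 1 - t := by fun_prop
  have m4 : Measurable fun t : ℝ => 2 / 3 - 2 * t := by fun_prop
  -- The thresholds `t`, `t + 1 / 3` and `1 - t` cover the unit interval.
  have h1 : ∀ i, ∫ t in (0 : ℝ)..1 / 3, (between (x i) (y i) t + between (x i) (y i) (t + 1 / 3) +
      between (x i) (y i) (1 - t)) ≤ |x i - y i| := by
    intro i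
    rw [intervalIntegral.integral_add ((hI i m1 _ _).add (hI i m2 _ _)) (hI i m3 _ _),
      intervalIntegral.integral_add (hI i m1 _ _) (hI i m2 _ _),
      intervalIntegral.integral_comp_add_right, intervalIntegral.integral_comp_sub_left,
      show (0 : ℝ) + 1 / 3 = 1 / 3 by norm_num, show (1 : ℝ) / 3 + 1 / 3 = 2 / 3 by norm_num,
      show (1 : ℝ) - 1 / 3 = 2 / 3 by norm_num, sub_zero,
      intervalIntegral.integral_add_adjacent_intervals (hI i m1 _ _) (hI i m1 _ _),
      intervalIntegral.integral_add_adjacent_intervals (hI i m1 _ _) (hI i m1 _ _)]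
    exact integral_between_le _ _
  have h2 : ∀ i, ∫ t in (0 : ℝ)..1 / 3, (2 * between (x i) (y i) (2 / 3 - 2 * t) +
      between (x i) (y i) (1 - t)) ≤ |x i - y i| := by
    intro i
    rw [intervalIntegral.integral_add ((hI i m4 _ _).const_mul 2) (hI i m3 _ _),
      intervalIntegral.integral_const_mul,
      intervalIntegral.integral_comp_sub_mul _ two_ne_zero, intervalIntegral.integral_comp_sub_left,
      show (2 : ℝ) / 3 - 2 * (1 / 3) = 0 by norm_num, show (2 : ℝ) / 3 - 2 * 0 = 2 / 3 by norm_num,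
      show (1 : ℝ) - 1 / 3 = 2 / 3 by norm_num, sub_zero, smul_eq_mul,
      mul_inv_cancel_left₀ two_ne_zero,
      intervalIntegral.integral_add_adjacent_intervals (hI i m1 _ _) (hI i m1 _ _)]
    exact integral_between_le _ _
  have hJ : ∀ i, IntervalIntegrable (fun t => between (x i) (y i) t +
      between (x i) (y i) (t + 1 / 3) + between (x i) (y i) (1 - t)) volume 0 (1 / 3) :=
    fun i => ((hI i m1 _ _).add (hI i m2 _ _)).add (hI i m3 _ _)
  unfold separationBound
  rw [intervalIntegral.integral_add ((hJ 0).add (hJ 1))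
      (((hI 2 m4 _ _).const_mul 2).add (hI 2 m3 _ _)),
    intervalIntegral.integral_add (hJ 0) (hJ 1), halfL1, Fin.sum_univ_three]
  have := h1 0
  have := h1 1
  have := h2 2
  linarith

theorem intervalIntegrable_separationBound (x y : Fin 3 → ℝ) (c d : ℝ) :
    IntervalIntegrable (separationBound x y) volume c d := by
  have hI : ∀ (i : Fin 3) {f : ℝ → ℝ}, Measurable f →
      IntervalIntegrable (fun t => between (x i) (y i) (f t)) volume c d :=
    fun i f hf => intervalIntegrable_between _ _ hf c d
  have m1 : Measurable fun t : ℝ => t := measurable_id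
  have m2 : Measurable fun t : ℝ => t + 1 / 3 := by fun_prop
  have m3 : Measurable fun t : ℝ => 1 - t := by fun_prop
  have m4 : Measurable fun t : ℝ => 2 / 3 - 2 * t := by fun_prop
  exact ((((hI 0 m1).add (hI 0 m2)).add (hI 0 m3)).add
    (((hI 1 m1).add (hI 1 m2)).add (hI 1 m3))).add
    (((hI 2 m4).const_mul 2).add (hI 2 m3))

open Classical in
/-- The cut of least cost is no worse than the average of the random cuts. -/
theorem minCutCost_le_mul_volume {G : Instance 3} (x : G.Embedding) :
    G.minCutCost ≤ 12 / 11 * x.volume := by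
  obtain ⟨u, v, huv⟩ : ∃ u v : Sym2 G.V → G.V, ∀ e, s(u e, v e) = e := by
    have h : ∀ e : Sym2 G.V, ∃ u v, s(u, v) = e := fun e => by
      induction e with
      | _ a b => exact ⟨a, b, rfl⟩
    choose u v huv using h
    exact ⟨u, v, huv⟩
  have hsum : ∀ w, x.pos w 0 + x.pos w 1 + x.pos w 2 = 1 := fun w => by
    rw [← Fin.sum_univ_three]; exact (x.pos w).2.2
  have hpoint : ∀ t ∈ Set.Ioo (0 : ℝ) (1 / 3), G.minCutCost ≤ ∑ e ∈ G.graph.edgeFinset,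
      G.cost e * (2 / 11 * separationBound (x.pos (u e)) (x.pos (v e)) t) := by
    rintro t ⟨h0, h1⟩
    have hcenter : ∀ σ b, G.minCutCost ≤ ∑ e ∈ G.graph.edgeFinset, G.cost e *
        separation (centerCut (center σ t) b (x.pos (u e)))
          (centerCut (center σ t) b (x.pos (v e))) := fun σ b =>
      minCutCost_le G huv (fun w => centerCut (center σ t) b (x.pos w)) fun i => by
        rw [x.pos_terminal]; exact centerCut_vertex σ h0 h1 b i
    have hcorner : ∀ l, G.minCutCost ≤ ∑ e ∈ G.graph.edgeFinset, G.cost e *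
        separation (cornerCut l t (x.pos (u e))) (cornerCut l t (x.pos (v e))) := fun l =>
      minCutCost_le G huv (fun w => cornerCut l t (x.pos w)) fun i => by
        rw [x.pos_terminal]; exact cornerCut_vertex l h0 h1 i
    -- Each of the `16` cuts with a center has weight `1 / 22`, which is `8 / 11` in all, and each
    -- of the three cuts that slice off corners has weight `1 / 11`.
    have h2 : 16 * G.minCutCost ≤ ∑ e ∈ G.graph.edgeFinset, G.cost e *
        ∑ σ, ∑ b, separation (centerCut (center σ t) b (x.pos (u e)))
          (centerCut (center σ t) b (x.pos (v e))) := by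
      have h := Finset.sum_le_sum fun σ (_ : σ ∈ Finset.univ) =>
        Finset.sum_le_sum fun b (_ : b ∈ Finset.univ) => hcenter σ b
      refine le_of_eq_of_le ?_ (h.trans_eq ?_)
      · simp only [Finset.sum_const, Finset.card_univ, Fintype.card_bool, Fintype.card_prod,
          nsmul_eq_mul]
        push_cast
        ring
      · simp only [Finset.mul_sum]
        rw [Finset.sum_comm (s := G.graph.edgeFinset)]
        exact Finset.sum_congr rfl fun σ _ => Finset.sum_comm
    have h3 : 3 * G.minCutCost ≤ ∑ e ∈ G.graph.edgeFinset, G.cost e *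
        ∑ l, separation (cornerCut l t (x.pos (u e))) (cornerCut l t (x.pos (v e))) := by
      have h := Finset.sum_le_sum fun l (_ : l ∈ Finset.univ) => hcorner l
      refine le_of_eq_of_le ?_ (h.trans_eq ?_)
      · simp
      · simp only [Finset.mul_sum]
        exact Finset.sum_comm
    have h4 : ∑ e ∈ G.graph.edgeFinset, G.cost e *
        (1 / 22 * ∑ σ, ∑ b, separation (centerCut (center σ t) b (x.pos (u e)))
          (centerCut (center σ t) b (x.pos (v e))) +
        1 / 11 * ∑ l, separation (cornerCut l t (x.pos (u e))) (cornerCut l t (x.pos (v e)))) ≤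
        ∑ e ∈ G.graph.edgeFinset,
          G.cost e * (2 / 11 * separationBound (x.pos (u e)) (x.pos (v e)) t) :=
      Finset.sum_le_sum fun e _ => mul_le_mul_of_nonneg_left
        (sum_separation_le (hsum (u e)) (hsum (v e)) t) (G.cost_nonneg e)
    simp only [mul_add, Finset.sum_add_distrib, mul_left_comm _ (1 / 22 : ℝ),
      mul_left_comm _ (1 / 11 : ℝ), ← Finset.mul_sum (a := (1 / 22 : ℝ)),
      ← Finset.mul_sum (a := (1 / 11 : ℝ))] at h4
    linarith
  have hint : ∀ e ∈ G.graph.edgeFinset, IntervalIntegrable (fun t =>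
      G.cost e * (2 / 11 * separationBound (x.pos (u e)) (x.pos (v e)) t)) volume 0 (1 / 3) :=
    fun e _ => ((intervalIntegrable_separationBound _ _ _ _).const_mul _).const_mul _
  have hint' : IntervalIntegrable (fun t => ∑ e ∈ G.graph.edgeFinset,
      G.cost e * (2 / 11 * separationBound (x.pos (u e)) (x.pos (v e)) t)) volume 0 (1 / 3) := by
    have := IntervalIntegrable.sum _ hint
    simpa only [Finset.sum_fn] using this
  have hmono := intervalIntegral.integral_mono_on_of_le_Ioo (by norm_num : (0 : ℝ) ≤ 1 / 3)
    intervalIntegrable_const hint' hpoint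
  rw [intervalIntegral.integral_finsetSum hint] at hmono
  simp only [intervalIntegral.integral_const, intervalIntegral.integral_const_mul, smul_eq_mul,
    sub_zero] at hmono
  have hle : ∑ e ∈ G.graph.edgeFinset, G.cost e * (2 / 11 *
      ∫ t in (0 : ℝ)..1 / 3, separationBound (x.pos (u e)) (x.pos (v e)) t) ≤
      ∑ e ∈ G.graph.edgeFinset, 4 / 11 * (G.cost e * x.length e) := by
    refine Finset.sum_le_sum fun e _ => ?_
    have h1 := integral_separationBound_le (x.pos (u e)) (x.pos (v e))
    have h2 : x.length e = halfL1 (x.pos (u e)) (x.pos (v e)) := by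
      conv_lhs => rw [← huv e]
      rfl
    rw [mul_left_comm (4 / 11 : ℝ), h2]
    exact mul_le_mul_of_nonneg_left (by linarith) (G.cost_nonneg e)
  rw [← Finset.mul_sum] at hle
  change _ ≤ 4 / 11 * x.volume at hle
  linarith

/-! ### The integrality gap -/

theorem bddBelow_volumes (G : Instance 3) : BddBelow {c | ∃ x : G.Embedding, c = x.volume} := by
  refine ⟨0, ?_⟩
  rintro _ ⟨x, rfl⟩
  refine Finset.sum_nonneg fun e _ => mul_nonneg (G.cost_nonneg e) ?_
  induction e with
  | _ a b =>
    exact div_nonneg (Finset.sum_nonneg fun i _ => abs_nonneg _) zero_le_two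

theorem minCutCost_le_mul_minVolume {G : Instance 3} (x : G.Embedding) :
    G.minCutCost ≤ 12 / 11 * G.minVolume := by
  have h : 11 / 12 * G.minCutCost ≤ G.minVolume := by
    refine le_csInf ⟨_, x, rfl⟩ ?_
    rintro _ ⟨y, rfl⟩
    have := minCutCost_le_mul_volume y
    linarith
  linarith

theorem le_minCutCost_lowerBoundGraph {N : ℕ} (hN : 0 < N) :
    12 * (N : ℝ) ≤ (lowerBoundGraph N hN).minCutCost := by
  classical
  have hcut : (lowerBoundGraph N hN).IsCut (lowerBoundGraph N hN).graph.edgeFinset := by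
    refine ⟨by simp, fun i j hij h => hij ((lowerBoundGraph N hN).terminal_injective ?_)⟩
    simpa using h
  refine le_csInf ⟨_, _, hcut, rfl⟩ ?_
  rintro _ ⟨C, hC, rfl⟩
  exact le_cutCost hN hC

theorem isLUB_gapRatios : IsLUB (gapRatios 3) (12 / 11) := by
  constructor
  · rintro _ ⟨G, hG, rfl⟩
    rw [div_le_iff₀ hG]
    obtain ⟨x⟩ : Nonempty G.Embedding := by
      by_contra h
      rw [not_nonempty_iff] at h
      -- The infimum of the empty set of volumes would be `0`.
      simp [Instance.minVolume] at hG
    exact minCutCost_le_mul_minVolume x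
  · intro b hb
    refine twelve_div_eleven_le fun N hN => ?_
    have hcut := le_minCutCost_lowerBoundGraph hN
    have hle := minCutCost_le_mul_minVolume (lowerBoundEmbedding N hN)
    have hvol : (lowerBoundGraph N hN).minVolume ≤ 11 * N + 1 :=
      csInf_le (bddBelow_volumes _) ⟨_, (volume_lowerBoundEmbedding N hN).symm⟩
    have hN' : (0 : ℝ) < N := by exact_mod_cast hN
    have hpos : 0 < (lowerBoundGraph N hN).minVolume := by linarith
    have h := hb ⟨_, hpos, rfl⟩
    rw [div_le_iff₀ hpos] at h
    have hb0 : 0 ≤ b := by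
      by_contra! hneg
      have := mul_neg_of_neg_of_pos hneg hpos
      linarith
    have := mul_le_mul_of_nonneg_left hvol hb0
    linarith

end MultiwayCut

theorem mainTheorem2 :
    -- the graphs `G_N`
    (∀ (N : ℕ) (hN : 0 < N),
      (MultiwayCut.lowerBoundEmbedding N hN).IsPlane ∧
      (MultiwayCut.lowerBoundEmbedding N hN).volume = 11 * N + 1 ∧
      ∀ C, (MultiwayCut.lowerBoundGraph N hN).IsCut C →
        12 * (N : ℝ) ≤ (MultiwayCut.lowerBoundGraph N hN).cutCost C) ∧
    -- every cutting scheme has maximum density at least `12 / 11`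
    (∀ P : MultiwayCut.CuttingScheme 3,
      12 / 11 ≤ MultiwayCut.maxDensity P ∧ 12 / 11 ≤ MultiwayCut.maxSeparationDensity P) ∧
    12 / 11 ≤ MultiwayCut.minMaxDensity 3 ∧
    -- the integrality gap for three terminals is `12 / 11`
    IsLUB (MultiwayCut.gapRatios 3) (12 / 11) := by
  have hP : ∀ P : MultiwayCut.CuttingScheme 3,
      12 / 11 ≤ MultiwayCut.maxDensity P ∧ 12 / 11 ≤ MultiwayCut.maxSeparationDensity P :=
    fun P => ⟨(MultiwayCut.twelve_div_eleven_le_maxSeparationDensity P).trans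
      (MultiwayCut.maxSeparationDensity_le_maxDensity P),
      MultiwayCut.twelve_div_eleven_le_maxSeparationDensity P⟩
  exact ⟨fun N hN => ⟨MultiwayCut.isPlane_lowerBoundEmbedding N hN,
    MultiwayCut.volume_lowerBoundEmbedding N hN, fun C hC => MultiwayCut.le_cutCost hN hC⟩,
    hP, le_iInf fun P => (hP P).1, MultiwayCut.isLUB_gapRatios⟩
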